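/- All spaces are standard probability spaces and $A=L^\infty(X,\mu)$, with unitary group $\mathcal U(A)$. A full groupoid $\mathcal G$ on $(X,\mu)$ is a set of measure preserving isomorphisms $\phi:R\simeq L$ between measurable subsets of $X$, modulo null sets, which is closed under composition (on the natural domain) and inverses, contains $\mathrm{id}_Y$ for all measurable $Y\subset X$, and contains $\phi$ whenever it contains the restrictions of $\phi$ to the members of a countable measurable partition of its domain. It is ergodic if every $\mathcal G$-invariant measurable set is null or conull. Put $\phi(a)=a\circ\phi^{-1}$ on the range $r(\phi)$ of $\phi$ and $\phi(a)=0$ elsewhere. A $1$-cocycle of $\mathcal G$ is a map $w$ from $\mathcal G$ to the partial isometries of $A$ with $w_\phi w_\phi^*=\chi_{r(\phi)}$ and $w_{\phi\psi}=w_\phi\,\phi(w_\psi)$ for all $\phi,\psi\in\mathcal G$. The cocycles form a commutative group $\mathrm Z^1(\mathcal G)$ under pointwise multiplication, with the topology of pointwise $\|\cdot\|_2$-convergence; $\mathrm B^1(\mathcal G)$ is the subgroup of the cocycles $\phi\mapsto u^*\phi(u)$, $u\in\mathcal U(A)$, and $\mathrm H^1(\mathcal G)=\mathrm Z^1(\mathcal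 G)/\mathrm B^1(\mathcal G)$ has the quotient topology. For a measure preserving action $\sigma$ of a countable group $G$ on $(X,\mu)$, $\mathrm Z^1(\sigma)$ is the group of maps $w:G\to\mathcal U(A)$ with $w_{gh}=w_g\sigma_g(w_h)$, with the same kind of topology, $\mathrm B^1(\sigma)=\{(u^*\sigma_g(u))_g\mid u\in\mathcal U(A)\}$, $\mathrm H^1(\sigma)=\mathrm Z^1(\sigma)/\mathrm B^1(\sigma)$, and $\mathcal G_\sigma$ is the full groupoid of the local isomorphisms $\phi$ with $\phi(x)\in\sigma(G)x$ for a.e. $x$ in the domain of $\phi$. For $\mathcal G$ ergodic and $t>0$, the amplification $\mathcal G^t$, defined up to isomorphism, is the restriction of $\mathcal K_n$ to a measurable set $S\subset X\times\{1,\dots,n\}$ of measure $t/n$ (with the normalized measure), where $n\ge t$, $\{1,\dots,n\}$ has the uniform probability measure and $\mathcal K_n$ is the full groupoid generated by the products $\phi\times d$, with $\phi\in\mathcal G$ and $d$ a partial bijection of $\{1,\dots,n\}$. Two free ergodic actions $\sigma,\rho$ are stably orbit equivalent if $\mathcal G_\sigma\simeq\mathcal G_\rho^t$ for some $t>0$,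 and orbit equivalent if some isomorphism of the probability spaces takes almost every orbit onto an orbit. $1^\circ$. Let $\mathcal G$ be an ergodic full groupoid, $t>0$, and $\mathcal G^t=\mathcal K_n|_S$ as above. Then $\mathrm H^1(\mathcal G^t)$ is naturally isomorphic to $\mathrm H^1(\mathcal G)$ as a topological group: there is a unique isomorphism of topological groups $\Phi:\mathrm H^1(\mathcal G)\to\mathrm H^1(\mathcal K_n|_S)$ such that, for each $w\in\mathrm Z^1(\mathcal K_n)$ and each $i\in\{1,\dots,n\}$, $\Phi$ takes the class of the restriction of $w$ to $\mathcal G\simeq\mathcal G\times\{\mathrm{id}_{\{i\}}\}$ to the class of the restriction of $w$ to $\mathcal K_n|_S$. $2^\circ$. Let $\sigma$ be a free ergodic measure preserving action of a countable group $G$. Then $w\mapsto(w_{\sigma_g})_{g\in G}$ is an isomorphism of topological groups from $\mathrm Z^1(\mathcal G_\sigma)$ onto $\mathrm Z^1(\sigma)$ which takes $\mathrm B^1(\mathcal G_\sigma)$ onto $\mathrm B^1(\sigma)$ and induces an isomorphism of topological groups $\mathrm H^1(\mathcal G_\sigma)\simeq\mathrm H^1(\sigma)$. If $\sigma$ and $\rho$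 are free ergodic measure preserving actions of countable groups which are stably orbit equivalent, then $\mathrm H^1(\sigma)\simeq\mathrm H^1(\rho)$ as topological groups. If they are orbit equivalent, then $\mathrm Z^1(\sigma)\simeq\mathrm Z^1(\rho)$ as topological groups. -/

import Mathlib

open MeasureTheory Set Filter
open scoped ENNReal Topology ComplexConjugate

noncomputable section

namespace FullGpd

variable {X Y : Type*} [MeasurableSpace X] [MeasurableSpace Y]

/-! ### Measure preserving local isomorphisms -/

/-- A measure preserving isomorphism `φ : R ≃ L` between measurable subsets `R = source` and
`L = target` of the measure space `(X, μ)`.  The maps `φ` and `φ⁻¹` are extended (in a measurable,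
otherwise irrelevant way) to all of `X`; only their values on `source`, resp. `target`, matter. -/
structure LocalIso (μ : Measure X) extends PartialEquiv X X where
  measurable_toFun : Measurable toFun
  measurable_invFun : Measurable invFun
  measurableSet_source : MeasurableSet source
  measurableSet_target : MeasurableSet target
  measure_image : ∀ E, MeasurableSet E → E ⊆ source → μ (toFun '' E) = μ E

namespace LocalIso

variable {μ : Measure X} {ν : Measure Y}

instance : CoeFun (LocalIso μ) (fun _ => X → X) := ⟨fun φ => φ.toFun⟩

/-- Equality modulo null sets. -/
def AEEq (φ ψ : LocalIso μ) : Prop :=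
  φ.source =ᵐ[μ] ψ.source ∧ ∀ᵐ x ∂μ, x ∈ φ.source → φ x = ψ x

/-- The inverse `φ⁻¹ : L ≃ R`. -/
def inv (φ : LocalIso μ) : LocalIso μ where
  toPartialEquiv := φ.toPartialEquiv.symm
  measurable_toFun := φ.measurable_invFun
  measurable_invFun := φ.measurable_toFun
  measurableSet_source := φ.measurableSet_target
  measurableSet_target := φ.measurableSet_source
  measure_image := by
    intro E hE hsub
    change E ⊆ φ.target at hsub
    have h1 : φ.toPartialEquiv.symm '' E = φ.source ∩ φ.toFun ⁻¹' E :=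
      φ.toPartialEquiv.symm_image_eq_source_inter_preimage hsub
    have h2 : φ.toFun '' (φ.toPartialEquiv.symm '' E) = E :=
      φ.toPartialEquiv.image_symm_image_of_subset_target hsub
    have hm : MeasurableSet (φ.toPartialEquiv.symm '' E) := by
      rw [h1]; exact φ.measurableSet_source.inter (φ.measurable_toFun hE)
    have := φ.measure_image _ hm (by rw [h1]; exact inter_subset_left)
    rw [h2] at this
    exact this.symm

theorem measurableSet_image (φ : LocalIso μ) {E : Set X} (hE : MeasurableSet E)
    (hsub : E ⊆ φ.source) : MeasurableSet (φ '' E) := by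
  have : φ.toFun '' E = φ.target ∩ φ.invFun ⁻¹' E :=
    φ.toPartialEquiv.image_eq_target_inter_inv_preimage hsub
  rw [this]
  exact φ.measurableSet_target.inter (φ.measurable_invFun hE)

/-- The composition `φ ψ = φ ∘ ψ`, on its natural domain `ψ⁻¹ (target ψ ∩ source φ)`. -/
def comp (φ ψ : LocalIso μ) : LocalIso μ where
  toPartialEquiv := ψ.toPartialEquiv.trans φ.toPartialEquiv
  measurable_toFun := φ.measurable_toFun.comp ψ.measurable_toFun
  measurable_invFun := ψ.measurable_invFun.comp φ.measurable_invFun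
  measurableSet_source := by
    rw [PartialEquiv.trans_source]
    exact ψ.measurableSet_source.inter (ψ.measurable_toFun φ.measurableSet_source)
  measurableSet_target := by
    rw [PartialEquiv.trans_target]
    exact φ.measurableSet_target.inter (φ.measurable_invFun ψ.measurableSet_target)
  measure_image := by
    intro E hE hsub
    rw [PartialEquiv.trans_source] at hsub
    have h1 : E ⊆ ψ.source := fun x hx => (hsub hx).1
    have h2 : ψ '' E ⊆ φ.source := by
      rintro _ ⟨x, hx, rfl⟩; exact (hsub hx).2
    change μ ((fun x => φ (ψ x)) '' E) = μ E
    rw [← ψ.measure_image E hE h1, ← φ.measure_image _ (ψ.measurableSet_image hE h1) h2,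
      image_image]

/-- The identity `id_S` of a measurable subset `S`. -/
def idOn (μ : Measure X) (S : Set X) (hS : MeasurableSet S) : LocalIso μ where
  toPartialEquiv := PartialEquiv.ofSet S
  measurable_toFun := measurable_id
  measurable_invFun := measurable_id
  measurableSet_source := hS
  measurableSet_target := hS
  measure_image := by
    intro E _ _
    change μ (id '' E) = μ E
    rw [image_id]

/-- The restriction `φ|_S : source ∩ S ≃ φ (source ∩ S)`. -/
def restr (φ : LocalIso μ) (S : Set X) (hS : MeasurableSet S) : LocalIso μ :=
  φ.comp (idOn μ S hS)

theorem null_preimage (φ : LocalIso μ) {N : Set X} (hN : μ N = 0) :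
    μ (φ.source ∩ φ ⁻¹' N) = 0 := by
  refine measure_mono_null (inter_subset_inter_right _ (preimage_mono (subset_toMeasurable μ N))) ?_
  rw [← φ.measure_image _
    (φ.measurableSet_source.inter (φ.measurable_toFun (measurableSet_toMeasurable μ N)))
    inter_subset_left]
  refine measure_mono_null ?_ ((measure_toMeasurable N).trans hN)
  rintro _ ⟨x, hx, rfl⟩
  exact hx.2

theorem ae_comp (φ : LocalIso μ) {p : X → Prop} (h : ∀ᵐ x ∂μ, p x) :
    ∀ᵐ x ∂μ, x ∈ φ.source → p (φ x) := by
  rw [ae_iff] at h ⊢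
  refine measure_mono_null ?_ (φ.null_preimage h)
  intro x hx
  simpa using hx

theorem ae_comp_inv (φ : LocalIso μ) {p : X → Prop} (h : ∀ᵐ x ∂μ, p x) :
    ∀ᵐ x ∂μ, x ∈ φ.target → p (φ.invFun x) := φ.inv.ae_comp h

theorem measurePreserving (φ : LocalIso μ) :
    MeasurePreserving φ (μ.restrict φ.source) (μ.restrict φ.target) := by
  refine ⟨φ.measurable_toFun, ?_⟩
  ext E hE
  rw [Measure.map_apply φ.measurable_toFun hE, Measure.restrict_apply hE,
    Measure.restrict_apply (φ.measurable_toFun hE),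
    ← φ.measure_image _ ((φ.measurable_toFun hE).inter φ.measurableSet_source) inter_subset_right]
  congr 1
  ext y
  constructor
  · rintro ⟨x, hx, rfl⟩
    exact ⟨hx.1, φ.map_source hx.2⟩
  · rintro ⟨h1, h2⟩
    exact ⟨φ.invFun y, ⟨by rw [mem_preimage, φ.right_inv' h2]; exact h1, φ.map_target h2⟩, φ.right_inv' h2⟩

theorem AEEq.symm {φ ψ : LocalIso μ} (h : φ.AEEq ψ) : ψ.AEEq φ := by
  refine ⟨h.1.symm, ?_⟩
  filter_upwards [h.1.mem_iff, h.2] with x h1 h2 hx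
  exact (h2 (h1.2 hx)).symm

theorem AEEq.target {φ ψ : LocalIso μ} (h : φ.AEEq ψ) : φ.target =ᵐ[μ] ψ.target := by
  have key : ∀ {φ ψ : LocalIso μ}, φ.AEEq ψ → ∀ᵐ x ∂μ, x ∈ φ.target → x ∈ ψ.target := by
    intro φ ψ h
    filter_upwards [φ.ae_comp_inv h.1.mem_iff, φ.ae_comp_inv h.2] with x h1 h2 hx
    have hs : φ.invFun x ∈ φ.source := φ.map_target' hx
    have h3 := h2 hx hs
    have h4 : ψ (φ.invFun x) ∈ ψ.target := ψ.map_source' ((h1 hx).1 hs)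
    rwa [← h3, φ.right_inv' hx] at h4
  filter_upwards [key h, key h.symm] with x h1 h2
  exact propext ⟨h1, h2⟩

/-- The product `φ × ψ` of local isomorphisms of `(X, μ)` and `(Y, ν)`. -/
def prod [SFinite μ] [SFinite ν] (φ : LocalIso μ) (ψ : LocalIso ν) : LocalIso (μ.prod ν) where
  toPartialEquiv := φ.toPartialEquiv.prod ψ.toPartialEquiv
  measurable_toFun := φ.measurable_toFun.prodMap ψ.measurable_toFun
  measurable_invFun := φ.measurable_invFun.prodMap ψ.measurable_invFun
  measurableSet_source := φ.measurableSet_source.prod ψ.measurableSet_source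
  measurableSet_target := φ.measurableSet_target.prod ψ.measurableSet_target
  measure_image := by
    intro E hE hsub
    have hmp := φ.inv.measurePreserving.prod ψ.inv.measurePreserving
    rw [Measure.prod_restrict, Measure.prod_restrict] at hmp
    set P := φ.toPartialEquiv.prod ψ.toPartialEquiv with hP
    have h1 : P.toFun '' E = P.target ∩ P.invFun ⁻¹' E :=
      P.image_eq_target_inter_inv_preimage hsub
    have h2 := hmp.measure_preimage hE.nullMeasurableSet
    rw [Measure.restrict_apply (hmp.measurable hE), Measure.restrict_apply hE] at h2
    rw [h1, inter_comm]
    refine h2.trans ?_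
    congr 1
    exact inter_eq_left.mpr hsub

end LocalIso

/-! ### The action of local isomorphisms on `A = L^∞(X, μ)` -/

variable {μ : Measure X}

/-- The projection `χ_S` of `A = L^∞(X, μ)`.  Elements of `A` are written as classes of measurable
functions modulo null sets; all those that occur below are bounded by `1`. -/
def chi (μ : Measure X) (S : Set X) (hS : MeasurableSet S) : X →ₘ[μ] ℂ :=
  AEEqFun.mk (S.indicator (fun _ => (1 : ℂ)))
    (stronglyMeasurable_const.indicator hS).aestronglyMeasurable

theorem coeFn_chi (S : Set X) (hS : MeasurableSet S) :
    chi μ S hS =ᵐ[μ] S.indicator (fun _ => (1 : ℂ)) := AEEqFun.coeFn_mk _ _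

/-- The partial isometry action of `φ` on functions: `φ(f) = f ∘ φ⁻¹` on the range of `φ`, and
`φ(f) = 0` off the range of `φ`. -/
def LocalIso.act (φ : LocalIso μ) (f : X →ₘ[μ] ℂ) : X →ₘ[μ] ℂ :=
  AEEqFun.mk (φ.target.indicator (fun x => f (φ.invFun x))) (by
    have h : Measurable (f : X → ℂ) := f.measurable
    exact ((h.comp φ.measurable_invFun).indicator φ.measurableSet_target).aestronglyMeasurable)

theorem LocalIso.coeFn_act (φ : LocalIso μ) (f : X →ₘ[μ] ℂ) :
    φ.act f =ᵐ[μ] φ.target.indicator (fun x => f (φ.invFun x)) := AEEqFun.coeFn_mk _ _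

theorem LocalIso.act_mul (φ : LocalIso μ) (f g : X →ₘ[μ] ℂ) :
    φ.act (f * g) = φ.act f * φ.act g := by
  apply AEEqFun.ext
  filter_upwards [φ.coeFn_act (f * g), φ.coeFn_act f, φ.coeFn_act g,
    AEEqFun.coeFn_mul (φ.act f) (φ.act g), φ.ae_comp_inv (AEEqFun.coeFn_mul f g)]
    with x h1 h2 h3 h4 h5
  rw [h1, h4, Pi.mul_apply, h2, h3]
  by_cases hx : x ∈ φ.target
  · simp only [indicator_of_mem hx, h5 hx, Pi.mul_apply]
  · simp [hx]

theorem LocalIso.act_star (φ : LocalIso μ) (f : X →ₘ[μ] ℂ) :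
    φ.act (star f) = star (φ.act f) := by
  apply AEEqFun.ext
  filter_upwards [φ.coeFn_act (star f), φ.coeFn_act f, AEEqFun.coeFn_star (φ.act f),
    φ.ae_comp_inv (AEEqFun.coeFn_star f)] with x h1 h2 h3 h4
  rw [h1, h3, Pi.star_apply, h2]
  by_cases hx : x ∈ φ.target
  · simp only [indicator_of_mem hx, h4 hx, Pi.star_apply]
  · simp [hx]

theorem LocalIso.act_chi (φ : LocalIso μ) (S : Set X) (hS : MeasurableSet S) :
    φ.act (chi μ S hS) = chi μ (φ.target ∩ φ.invFun ⁻¹' S)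
      (φ.measurableSet_target.inter (φ.measurable_invFun hS)) := by
  apply AEEqFun.ext
  filter_upwards [φ.coeFn_act (chi μ S hS), φ.ae_comp_inv (coeFn_chi (μ := μ) S hS),
    coeFn_chi (μ := μ) (φ.target ∩ φ.invFun ⁻¹' S)
      (φ.measurableSet_target.inter (φ.measurable_invFun hS))] with x h1 h2 h3
  rw [h1, h3]
  by_cases hx : x ∈ φ.target
  · by_cases hs : φ.invFun x ∈ S
    · rw [indicator_of_mem hx, h2 hx, indicator_of_mem hs,
        indicator_of_mem (show x ∈ φ.target ∩ φ.invFun ⁻¹' S from ⟨hx, hs⟩)]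
    · rw [indicator_of_mem hx, h2 hx, indicator_of_notMem hs, indicator_of_notMem (fun h => hs h.2)]
  · rw [indicator_of_notMem hx, indicator_of_notMem (fun h => hx h.1)]

theorem chi_mul_chi (S T : Set X) (hS : MeasurableSet S) (hT : MeasurableSet T) :
    chi μ S hS * chi μ T hT = chi μ (S ∩ T) (hS.inter hT) := by
  apply AEEqFun.ext
  filter_upwards [AEEqFun.coeFn_mul (chi μ S hS) (chi μ T hT), coeFn_chi (μ := μ) S hS,
    coeFn_chi (μ := μ) T hT, coeFn_chi (μ := μ) (S ∩ T) (hS.inter hT)] with x h1 h2 h3 h4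
  rw [h1, h4, Pi.mul_apply, h2, h3]
  by_cases hs : x ∈ S <;> by_cases ht : x ∈ T <;> simp [hs, ht]

theorem star_chi (S : Set X) (hS : MeasurableSet S) : star (chi μ S hS) = chi μ S hS := by
  apply AEEqFun.ext
  filter_upwards [AEEqFun.coeFn_star (chi μ S hS), coeFn_chi (μ := μ) S hS] with x h1 h2
  rw [h1, Pi.star_apply, h2]
  by_cases hs : x ∈ S <;> simp [hs]

theorem star_mul_fun (f g : X →ₘ[μ] ℂ) : star (f * g) = star f * star g := by
  apply AEEqFun.ext
  filter_upwards [AEEqFun.coeFn_star (f * g), AEEqFun.coeFn_mul f g,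
    AEEqFun.coeFn_mul (star f) (star g), AEEqFun.coeFn_star f, AEEqFun.coeFn_star g]
    with x h1 h2 h3 h4 h5
  rw [h1, h3, Pi.star_apply, h2, Pi.mul_apply, Pi.mul_apply, h4, h5]
  simp

/-- The inclusion `𝒰(A) ⊆ A`.  The unitary group `𝒰(A)` of `A = L^∞(X, μ)` is the group
`X →ₘ[μ] Circle` of classes of measurable functions of modulus one. -/
def toC (u : X →ₘ[μ] Circle) : X →ₘ[μ] ℂ := AEEqFun.comp (fun z : Circle => (z : ℂ)) continuous_subtype_val u

theorem coeFn_toC (u : X →ₘ[μ] Circle) : toC u =ᵐ[μ] fun x => (u x : ℂ) :=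
  AEEqFun.coeFn_comp _ _ _

theorem toC_mul (u v : X →ₘ[μ] Circle) : toC (u * v) = toC u * toC v := by
  apply AEEqFun.ext
  filter_upwards [coeFn_toC (u * v), coeFn_toC u, coeFn_toC v, AEEqFun.coeFn_mul u v,
    AEEqFun.coeFn_mul (toC u) (toC v)] with x h1 h2 h3 h4 h5
  rw [h1, h5, Pi.mul_apply, h2, h3, h4]
  simp

theorem toC_inv (u : X →ₘ[μ] Circle) : toC u⁻¹ = star (toC u) := by
  apply AEEqFun.ext
  filter_upwards [coeFn_toC u⁻¹, coeFn_toC u, AEEqFun.coeFn_inv u, AEEqFun.coeFn_star (toC u)]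
    with x h1 h2 h3 h4
  rw [h1, h4, h3, Pi.star_apply, h2]
  exact Circle.coe_inv_eq_conj _

theorem toC_one : toC (1 : X →ₘ[μ] Circle) = chi μ univ MeasurableSet.univ := by
  apply AEEqFun.ext
  filter_upwards [coeFn_toC (1 : X →ₘ[μ] Circle), AEEqFun.coeFn_one (β := Circle) (μ := μ),
    coeFn_chi (μ := μ) univ MeasurableSet.univ] with x h1 h2 h3
  rw [h1, h3, h2]
  simp

theorem ae_norm_toC_le (u : X →ₘ[μ] Circle) : ∀ᵐ x ∂μ, ‖toC u x‖ ≤ 1 := by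
  filter_upwards [coeFn_toC u] with x hx
  rw [hx]; exact (Circle.norm_coe _).le

/-- An element of the unit ball of `A`, regarded as an element of `L²(X, μ)`. -/
def toL2 [IsFiniteMeasure μ] (f : X →ₘ[μ] ℂ) (hf : ∀ᵐ x ∂μ, ‖f x‖ ≤ 1) : Lp ℂ 2 μ :=
  (MemLp.of_bound f.aestronglyMeasurable 1 hf : MemLp f 2 μ).toLp f

/-! ### Full groupoids -/

/-- A full groupoid acting on `(X, μ)`: a set of measure preserving local isomorphisms of
`(X, μ)`, regarded modulo null sets, which is closed under composition and inverses, contains the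
identities of all measurable subsets, and contains a local isomorphism as soon as it contains its
restrictions to the members of some countable measurable partition of its domain. -/
structure FullGroupoid (μ : Measure X) where
  carrier : Set (LocalIso μ)
  ae_mem : ∀ φ ψ, φ.AEEq ψ → φ ∈ carrier → ψ ∈ carrier
  comp_mem : ∀ φ ψ, φ ∈ carrier → ψ ∈ carrier → φ.comp ψ ∈ carrier
  inv_mem : ∀ φ, φ ∈ carrier → φ.inv ∈ carrier
  id_mem : ∀ S (hS : MeasurableSet S), LocalIso.idOn μ S hS ∈ carrier
  glue : ∀ (φ : LocalIso μ) (R : ℕ → Set X) (hR : ∀ n, MeasurableSet (R n)),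
    Pairwise (Function.onFun Disjoint R) → ⋃ n, R n = φ.source →
    (∀ n, φ.restr (R n) (hR n) ∈ carrier) → φ ∈ carrier

/-- Ergodicity: every `𝒢`-invariant measurable set is null or conull. -/
def FullGroupoid.Ergodic (𝒢 : FullGroupoid μ) : Prop :=
  ∀ E, MeasurableSet E → (∀ φ ∈ 𝒢.carrier, ∀ᵐ x ∂μ, x ∈ φ.source → (x ∈ E ↔ φ x ∈ E)) →
    μ E = 0 ∨ μ Eᶜ = 0

/-- The full groupoid generated by a set of local isomorphisms. -/
def FullGroupoid.generate (S : Set (LocalIso μ)) : FullGroupoid μ where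
  carrier := {φ | ∀ 𝒢 : FullGroupoid μ, S ⊆ 𝒢.carrier → φ ∈ 𝒢.carrier}
  ae_mem := fun φ ψ h hφ 𝒢 hS => 𝒢.ae_mem φ ψ h (hφ 𝒢 hS)
  comp_mem := fun φ ψ hφ hψ 𝒢 hS => 𝒢.comp_mem φ ψ (hφ 𝒢 hS) (hψ 𝒢 hS)
  inv_mem := fun φ hφ 𝒢 hS => 𝒢.inv_mem φ (hφ 𝒢 hS)
  id_mem := fun T hT 𝒢 _ => 𝒢.id_mem T hT
  glue := fun φ R hR hd hu h 𝒢 hS => 𝒢.glue φ R hR hd hu (fun n => h n 𝒢 hS)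

theorem FullGroupoid.subset_generate (S : Set (LocalIso μ)) :
    S ⊆ (FullGroupoid.generate S).carrier := fun _ hφ _ hS => hS hφ

/-! ### `1`-cohomology of full groupoids -/

/-- A `1`-cocycle of the full groupoid `𝒢`: a map `w` from `𝒢` to the partial isometries of
`A = L^∞(X, μ)` such that `w_φ w_φ^*` is the range `r(φ)` of `φ` and
`w_{φψ} = w_φ φ(w_ψ)` for all `φ, ψ ∈ 𝒢`. -/
@[ext]
structure Z1 (𝒢 : FullGroupoid μ) where
  val : 𝒢.carrier → (X →ₘ[μ] ℂ)
  congr : ∀ φ ψ, φ.1.AEEq ψ.1 → val φ = val ψ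
  range : ∀ φ, val φ * star (val φ) = chi μ φ.1.target φ.1.measurableSet_target
  cocycle : ∀ φ ψ, val ⟨φ.1.comp ψ.1, 𝒢.comp_mem _ _ φ.2 ψ.2⟩ = val φ * φ.1.act (val ψ)

namespace Z1

variable {𝒢 : FullGroupoid μ}

theorem ae_norm_le (w : Z1 𝒢) (φ : 𝒢.carrier) : ∀ᵐ x ∂μ, ‖w.val φ x‖ ≤ 1 := by
  have h := w.range φ
  filter_upwards [AEEqFun.coeFn_mul (w.val φ) (star (w.val φ)), AEEqFun.coeFn_star (w.val φ),
    coeFn_chi (μ := μ) φ.1.target φ.1.measurableSet_target] with x h1 h2 h3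
  rw [h, h3, Pi.mul_apply, h2, Pi.star_apply] at h1
  have h4 : ‖w.val φ x‖ * ‖w.val φ x‖ ≤ 1 := by
    have := congrArg norm h1
    rw [norm_mul, norm_star] at this
    rw [← this]
    by_cases hx : x ∈ φ.1.target <;> simp [hx]
  nlinarith [norm_nonneg (w.val φ x)]

/-- The cocycle `𝟏`. -/
instance : One (Z1 𝒢) where
  one :=
    { val := fun φ => chi μ φ.1.target φ.1.measurableSet_target
      congr := by
        intro φ ψ h
        apply AEEqFun.ext
        filter_upwards [coeFn_chi (μ := μ) φ.1.target φ.1.measurableSet_target,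
          coeFn_chi (μ := μ) ψ.1.target ψ.1.measurableSet_target, h.target.mem_iff]
          with x h1 h2 h3
        rw [h1, h2]
        by_cases hx : x ∈ φ.1.target
        · rw [indicator_of_mem hx, indicator_of_mem (h3.1 hx)]
        · rw [indicator_of_notMem hx, indicator_of_notMem (fun h => hx (h3.2 h))]
      range := fun φ => by rw [star_chi, chi_mul_chi]; congr 1; exact inter_self _
      cocycle := fun φ ψ => by
        rw [LocalIso.act_chi, chi_mul_chi]
        congr 1
        change (ψ.1.toPartialEquiv.trans φ.1.toPartialEquiv).target = _
        rw [PartialEquiv.trans_target]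
        exact (by rw [← inter_assoc, inter_self]; rfl) }

/-- Pointwise multiplication. -/
instance : Mul (Z1 𝒢) where
  mul w w' :=
    { val := fun φ => w.val φ * w'.val φ
      congr := fun φ ψ h => by rw [w.congr φ ψ h, w'.congr φ ψ h]
      range := fun φ => by
        rw [star_mul_fun, mul_mul_mul_comm, w.range, w'.range, chi_mul_chi]
        congr 1; exact inter_self _
      cocycle := fun φ ψ => by
        rw [w.cocycle, w'.cocycle, LocalIso.act_mul, mul_mul_mul_comm] }

/-- `(w⁻¹)_φ = w_φ^*`. -/
instance : Inv (Z1 𝒢) where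
  inv w :=
    { val := fun φ => star (w.val φ)
      congr := fun φ ψ h => by rw [w.congr φ ψ h]
      range := fun φ => by rw [star_star, mul_comm, w.range]
      cocycle := fun φ ψ => by rw [w.cocycle, star_mul_fun, LocalIso.act_star] }

theorem one_val (φ : 𝒢.carrier) :
    (1 : Z1 𝒢).val φ = chi μ φ.1.target φ.1.measurableSet_target := rfl

theorem mul_val (w w' : Z1 𝒢) (φ : 𝒢.carrier) : (w * w').val φ = w.val φ * w'.val φ := rfl

theorem inv_val (w : Z1 𝒢) (φ : 𝒢.carrier) : (w⁻¹).val φ = star (w.val φ) := rfl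

theorem chi_mul_val (w : Z1 𝒢) (φ : 𝒢.carrier) :
    chi μ φ.1.target φ.1.measurableSet_target * w.val φ = w.val φ := by
  have h := w.range φ
  apply AEEqFun.ext
  filter_upwards [AEEqFun.coeFn_mul (w.val φ) (star (w.val φ)), AEEqFun.coeFn_star (w.val φ),
    AEEqFun.coeFn_mul (chi μ φ.1.target φ.1.measurableSet_target) (w.val φ),
    coeFn_chi (μ := μ) φ.1.target φ.1.measurableSet_target] with x h1 h2 h3 h4
  rw [h, h4, Pi.mul_apply, h2, Pi.star_apply] at h1
  rw [h3, Pi.mul_apply, h4]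
  by_cases hx : x ∈ φ.1.target
  · simp [hx]
  · simp only [hx, not_false_eq_true, indicator_of_notMem] at h1
    have : w.val φ x = 0 := by simpa using h1.symm
    simp [this]

instance : CommGroup (Z1 𝒢) where
  mul_assoc a b c := by ext1; funext φ; simp only [mul_val, mul_assoc]
  mul_comm a b := by ext1; funext φ; simp only [mul_val, mul_comm]
  one_mul a := by ext1; funext φ; rw [mul_val, one_val, chi_mul_val]
  mul_one a := by ext1; funext φ; rw [mul_val, one_val, mul_comm, chi_mul_val]
  inv_mul_cancel a := by ext1; funext φ; rw [mul_val, inv_val, one_val, mul_comm, a.range]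

/-- The topology of pointwise convergence in the norm `‖·‖₂` of `L²(X, μ)`. -/
instance [IsFiniteMeasure μ] : TopologicalSpace (Z1 𝒢) :=
  TopologicalSpace.induced
    (fun w (φ : 𝒢.carrier) => toL2 (w.val φ) (w.ae_norm_le φ)) Pi.topologicalSpace

end Z1

/-- The group of coboundaries: the cocycles of the form `φ ↦ u^* φ(u)`, with `u ∈ 𝒰(A)`. -/
def B1 (𝒢 : FullGroupoid μ) : Subgroup (Z1 𝒢) where
  carrier := {w | ∃ u : X →ₘ[μ] Circle, ∀ φ, w.val φ = star (toC u) * φ.1.act (toC u)}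
  mul_mem' := by
    rintro w w' ⟨u, hu⟩ ⟨v, hv⟩
    refine ⟨u * v, fun φ => ?_⟩
    rw [Z1.mul_val, hu, hv, toC_mul, star_mul_fun, LocalIso.act_mul, mul_mul_mul_comm]
  one_mem' := by
    refine ⟨1, fun φ => ?_⟩
    rw [Z1.one_val, toC_one, star_chi, LocalIso.act_chi, chi_mul_chi]
    congr 1
    simp
  inv_mem' := by
    rintro w ⟨u, hu⟩
    refine ⟨u⁻¹, fun φ => ?_⟩
    rw [Z1.inv_val, hu, toC_inv, star_mul_fun, LocalIso.act_star]

/-- The first cohomology group `H¹(𝒢) = Z¹(𝒢) / B¹(𝒢)`, with its quotient topology. -/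
abbrev H1 (𝒢 : FullGroupoid μ) : Type _ := Z1 𝒢 ⧸ B1 𝒢
/-! ### Isomorphisms, restrictions and amplifications -/

/-- An isomorphism, modulo null sets, of the measure space `(X, μ)` onto a measurable subset
(`target`) of the measure space `(Y, ν)`, up to a rescaling of the measure by a constant.  As for
local isomorphisms, only the values on `source`, resp. of the inverse on `target`, matter. -/
structure Embed (μ : Measure X) (ν : Measure Y) extends PartialEquiv X Y where
  measurable_toFun : Measurable toFun
  measurable_invFun : Measurable invFun
  measurableSet_source : MeasurableSet source
  measurableSet_target : MeasurableSet target
  source_conull : μ sourceᶜ = 0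
  measure_image : ∃ c : ℝ≥0∞, c ≠ 0 ∧ c ≠ ∞ ∧
    ∀ E, MeasurableSet E → E ⊆ source → ν (toFun '' E) = c * μ E

namespace Embed

variable {ν : Measure Y}

instance : CoeFun (Embed μ ν) (fun _ => X → Y) := ⟨fun Θ => Θ.toFun⟩

theorem ae_source (Θ : Embed μ ν) : ∀ᵐ x ∂μ, x ∈ Θ.source := by
  rw [ae_iff]; exact Θ.source_conull

theorem measurableSet_image (Θ : Embed μ ν) {E : Set X} (hE : MeasurableSet E)
    (hsub : E ⊆ Θ.source) : MeasurableSet (Θ '' E) := by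
  have : Θ.toFun '' E = Θ.target ∩ Θ.invFun ⁻¹' E :=
    Θ.toPartialEquiv.image_eq_target_inter_inv_preimage hsub
  rw [this]
  exact Θ.measurableSet_target.inter (Θ.measurable_invFun hE)

theorem quasiMeasurePreserving (Θ : Embed μ ν) : Measure.QuasiMeasurePreserving Θ μ ν := by
  refine ⟨Θ.measurable_toFun, Measure.AbsolutelyContinuous.mk fun N hN h0 => ?_⟩
  rw [Measure.map_apply Θ.measurable_toFun hN]
  obtain ⟨c, hc0, hct, hc⟩ := Θ.measure_image
  have h1 := hc (Θ ⁻¹' N ∩ Θ.source)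
    ((Θ.measurable_toFun hN).inter Θ.measurableSet_source) inter_subset_right
  have h2 : ν (Θ '' (Θ ⁻¹' N ∩ Θ.source)) = 0 := by
    refine measure_mono_null ?_ h0
    rintro _ ⟨x, hx, rfl⟩
    exact hx.1
  rw [h2] at h1
  have h3 : μ (Θ ⁻¹' N ∩ Θ.source) = 0 := by
    rcases mul_eq_zero.1 h1.symm with h | h
    · exact absurd h hc0
    · exact h
  refine measure_mono_null (t := (Θ ⁻¹' N ∩ Θ.source) ∪ Θ.sourceᶜ) ?_
    (measure_union_null h3 Θ.source_conull)
  intro x hx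
  by_cases h : x ∈ Θ.source
  · exact Or.inl ⟨hx, h⟩
  · exact Or.inr h

theorem ae_comp (Θ : Embed μ ν) {p : Y → Prop} (h : ∀ᵐ y ∂ν, p y) : ∀ᵐ x ∂μ, p (Θ x) :=
  Θ.quasiMeasurePreserving.ae h

theorem ae_comp_inv (Θ : Embed μ ν) {p : X → Prop} (h : ∀ᵐ x ∂μ, p x) :
    ∀ᵐ y ∂ν, y ∈ Θ.target → p (Θ.invFun y) := by
  rw [ae_iff] at h ⊢
  obtain ⟨c, -, -, hc⟩ := Θ.measure_image
  have h1 := hc (toMeasurable μ {x | ¬ p x} ∩ Θ.source)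
    ((measurableSet_toMeasurable _ _).inter Θ.measurableSet_source) inter_subset_right
  rw [measure_mono_null inter_subset_left ((measure_toMeasurable _).trans h), mul_zero] at h1
  refine measure_mono_null ?_ h1
  intro y hy
  have hy' : y ∈ Θ.target ∧ ¬ p (Θ.invFun y) := by simpa using hy
  exact ⟨Θ.invFun y, ⟨subset_toMeasurable _ _ hy'.2, Θ.map_target' hy'.1⟩, Θ.right_inv' hy'.1⟩

/-- The local isomorphism `Θ φ Θ⁻¹` of `(Y, ν)`. -/
def push (Θ : Embed μ ν) (φ : LocalIso μ) : LocalIso ν where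
  toPartialEquiv := Θ.toPartialEquiv.symm.trans (φ.toPartialEquiv.trans Θ.toPartialEquiv)
  measurable_toFun := Θ.measurable_toFun.comp (φ.measurable_toFun.comp Θ.measurable_invFun)
  measurable_invFun := Θ.measurable_toFun.comp (φ.measurable_invFun.comp Θ.measurable_invFun)
  measurableSet_source := by
    rw [PartialEquiv.trans_source, PartialEquiv.trans_source]
    exact Θ.measurableSet_target.inter (Θ.measurable_invFun
      (φ.measurableSet_source.inter (φ.measurable_toFun Θ.measurableSet_source)))
  measurableSet_target := by
    rw [PartialEquiv.trans_target, PartialEquiv.trans_target]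
    refine MeasurableSet.inter (Θ.measurableSet_target.inter
      (Θ.measurable_invFun φ.measurableSet_target)) ?_
    exact (φ.measurable_invFun.comp Θ.measurable_invFun) Θ.measurableSet_source
  measure_image := by
    intro E hE hsub
    rw [PartialEquiv.trans_source, PartialEquiv.trans_source] at hsub
    obtain ⟨c, -, -, hc⟩ := Θ.measure_image
    have hET : E ⊆ Θ.target := fun y hy => (hsub hy).1
    have hF : Θ.invFun '' E = Θ.source ∩ Θ ⁻¹' E :=
      Θ.toPartialEquiv.symm_image_eq_source_inter_preimage hET
    have hFm : MeasurableSet (Θ.invFun '' E) := by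
      rw [hF]; exact Θ.measurableSet_source.inter (Θ.measurable_toFun hE)
    have hFs : Θ.invFun '' E ⊆ Θ.source := by rw [hF]; exact inter_subset_left
    have hFE : Θ '' (Θ.invFun '' E) = E := Θ.toPartialEquiv.image_symm_image_of_subset_target hET
    have hFφ : Θ.invFun '' E ⊆ φ.source := by
      rintro _ ⟨y, hy, rfl⟩; exact (hsub hy).2.1
    have hφF : φ '' (Θ.invFun '' E) ⊆ Θ.source := by
      rintro _ ⟨_, ⟨y, hy, rfl⟩, rfl⟩; exact (hsub hy).2.2
    have h1 := hc _ (φ.measurableSet_image hFm hFφ) hφF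
    rw [φ.measure_image _ hFm hFφ, ← hc _ hFm hFs, hFE, image_image, image_image] at h1
    exact h1

theorem mem_push_source (Θ : Embed μ ν) (φ : LocalIso μ) (y : Y) :
    y ∈ (Θ.push φ).source ↔
      y ∈ Θ.target ∧ Θ.invFun y ∈ φ.source ∧ φ (Θ.invFun y) ∈ Θ.source := Iff.rfl

theorem push_apply (Θ : Embed μ ν) (φ : LocalIso μ) (y : Y) :
    Θ.push φ y = Θ (φ (Θ.invFun y)) := rfl

theorem push_invFun (Θ : Embed μ ν) (φ : LocalIso μ) (y : Y) :
    (Θ.push φ).invFun y = Θ (φ.invFun (Θ.invFun y)) := rfl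

theorem mem_push_target (Θ : Embed μ ν) (φ : LocalIso μ) (y : Y) :
    y ∈ (Θ.push φ).target ↔
      y ∈ Θ.target ∧ Θ.invFun y ∈ φ.target ∧ φ.invFun (Θ.invFun y) ∈ Θ.source := by
  change y ∈ (Θ.toPartialEquiv.symm.trans (φ.toPartialEquiv.trans Θ.toPartialEquiv)).target ↔ _
  rw [PartialEquiv.trans_target, PartialEquiv.trans_target]
  exact and_assoc

theorem push_inv (Θ : Embed μ ν) (φ : LocalIso μ) : (Θ.push φ.inv).AEEq (Θ.push φ).inv := by
  refine ⟨?_, Eventually.of_forall fun y _ => rfl⟩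
  refine Eventually.of_forall fun y => propext ?_
  exact (Θ.mem_push_target φ y).symm

theorem push_aeeq (Θ : Embed μ ν) {φ ψ : LocalIso μ} (h : φ.AEEq ψ) :
    (Θ.push φ).AEEq (Θ.push ψ) := by
  have h1 := Θ.ae_comp_inv h.1.mem_iff
  have h2 := Θ.ae_comp_inv h.2
  constructor
  · filter_upwards [h1, h2] with y h1 h2
    refine propext ?_
    change y ∈ (Θ.push φ).source ↔ y ∈ (Θ.push ψ).source
    rw [mem_push_source, mem_push_source]
    constructor
    · rintro ⟨a, b, c⟩
      exact ⟨a, (h1 a).1 b, by rw [← h2 a b]; exact c⟩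
    · rintro ⟨a, b, c⟩
      have b' := (h1 a).2 b
      exact ⟨a, b', by rw [h2 a b']; exact c⟩
  · filter_upwards [h2] with y h2 hy
    rw [push_apply, push_apply, h2 hy.1 hy.2.1]

theorem push_comp (Θ : Embed μ ν) (φ ψ : LocalIso μ) :
    (Θ.push (φ.comp ψ)).AEEq ((Θ.push φ).comp (Θ.push ψ)) := by
  have key : ∀ᵐ y ∂ν, y ∈ Θ.target → Θ.invFun y ∈ ψ.source → ψ (Θ.invFun y) ∈ Θ.source :=
    Θ.ae_comp_inv (ψ.ae_comp Θ.ae_source)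
  constructor
  · filter_upwards [key] with y hy
    refine propext ?_
    change y ∈ (Θ.push (φ.comp ψ)).source ↔
      y ∈ (Θ.push ψ).source ∧ Θ.push ψ y ∈ (Θ.push φ).source
    rw [mem_push_source, mem_push_source, mem_push_source, push_apply]
    constructor
    · rintro ⟨a, ⟨b, b'⟩, c⟩
      have d := hy a b
      refine ⟨⟨a, b, d⟩, Θ.map_source' d, ?_, ?_⟩
      · rw [Θ.left_inv' d]; exact b'
      · rw [Θ.left_inv' d]; exact c
    · rintro ⟨⟨a, b, d⟩, -, e, f⟩
      rw [Θ.left_inv' d] at e f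
      exact ⟨a, ⟨b, e⟩, f⟩
  · filter_upwards [key] with y hy hys
    rw [mem_push_source] at hys
    have d := hy hys.1 hys.2.1.1
    change Θ (φ (ψ (Θ.invFun y))) = Θ (φ (Θ.invFun (Θ (ψ (Θ.invFun y)))))
    rw [Θ.left_inv' d]

/-- `Θ^{-1}(f) = f ∘ Θ`. -/
def pull (Θ : Embed μ ν) (f : Y →ₘ[ν] ℂ) : X →ₘ[μ] ℂ :=
  f.compQuasiMeasurePreserving Θ Θ.quasiMeasurePreserving

theorem coeFn_pull (Θ : Embed μ ν) (f : Y →ₘ[ν] ℂ) : Θ.pull f =ᵐ[μ] fun x => f (Θ x) :=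
  AEEqFun.coeFn_compQuasiMeasurePreserving f _

theorem pull_mul (Θ : Embed μ ν) (f g : Y →ₘ[ν] ℂ) : Θ.pull (f * g) = Θ.pull f * Θ.pull g := by
  apply AEEqFun.ext
  filter_upwards [Θ.coeFn_pull (f * g), Θ.coeFn_pull f, Θ.coeFn_pull g,
    AEEqFun.coeFn_mul (Θ.pull f) (Θ.pull g), Θ.ae_comp (AEEqFun.coeFn_mul f g)]
    with x h1 h2 h3 h4 h5
  rw [h1, h4, h5, Pi.mul_apply, Pi.mul_apply, h2, h3]

theorem pull_star (Θ : Embed μ ν) (f : Y →ₘ[ν] ℂ) : Θ.pull (star f) = star (Θ.pull f) := by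
  apply AEEqFun.ext
  filter_upwards [Θ.coeFn_pull (star f), Θ.coeFn_pull f, AEEqFun.coeFn_star (Θ.pull f),
    Θ.ae_comp (AEEqFun.coeFn_star f)] with x h1 h2 h3 h4
  rw [h1, h3, h4, Pi.star_apply, Pi.star_apply, h2]

theorem mem_push_target_ae (Θ : Embed μ ν) (φ : LocalIso μ) :
    ∀ᵐ x ∂μ, Θ x ∈ (Θ.push φ).target ↔ x ∈ φ.target := by
  filter_upwards [Θ.ae_source, φ.ae_comp_inv Θ.ae_source] with x h1 h2
  rw [mem_push_target, Θ.left_inv' h1]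
  exact ⟨fun h => h.2.1, fun h => ⟨Θ.map_source' h1, h, h2 h⟩⟩

theorem pull_chi (Θ : Embed μ ν) (φ : LocalIso μ) :
    Θ.pull (chi ν (Θ.push φ).target (Θ.push φ).measurableSet_target) =
      chi μ φ.target φ.measurableSet_target := by
  apply AEEqFun.ext
  filter_upwards [Θ.coeFn_pull (chi ν (Θ.push φ).target (Θ.push φ).measurableSet_target),
    Θ.ae_comp (coeFn_chi (μ := ν) (Θ.push φ).target (Θ.push φ).measurableSet_target),
    coeFn_chi (μ := μ) φ.target φ.measurableSet_target, Θ.mem_push_target_ae φ] with x h1 h2 h3 h4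
  rw [h1, h2, h3]
  by_cases hx : x ∈ φ.target
  · rw [indicator_of_mem hx, indicator_of_mem (h4.2 hx)]
  · rw [indicator_of_notMem hx, indicator_of_notMem (fun h => hx (h4.1 h))]

theorem pull_act (Θ : Embed μ ν) (φ : LocalIso μ) (f : Y →ₘ[ν] ℂ) :
    Θ.pull ((Θ.push φ).act f) = φ.act (Θ.pull f) := by
  apply AEEqFun.ext
  filter_upwards [Θ.coeFn_pull ((Θ.push φ).act f), Θ.ae_comp ((Θ.push φ).coeFn_act f),
    φ.coeFn_act (Θ.pull f), φ.ae_comp_inv (Θ.coeFn_pull f), Θ.mem_push_target_ae φ,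
    Θ.ae_source] with x h1 h2 h3 h4 h5 h6
  rw [h1, h2, h3]
  by_cases hx : x ∈ φ.target
  · rw [indicator_of_mem hx, indicator_of_mem (h5.2 hx), h4 hx, push_invFun, Θ.left_inv' h6]
  · rw [indicator_of_notMem hx, indicator_of_notMem (fun h => hx (h5.1 h))]

end Embed

/-- The full groupoid `{φ | Θ φ Θ⁻¹ ∈ 𝒢}` on `(X, μ)`, for an isomorphism `Θ` of `(X, μ)` onto a
subset of the space on which `𝒢` acts. -/
def FullGroupoid.pullback {ν : Measure Y} (𝒢 : FullGroupoid ν) (Θ : Embed μ ν) :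
    FullGroupoid μ where
  carrier := {φ | Θ.push φ ∈ 𝒢.carrier}
  ae_mem := fun φ ψ h hφ => 𝒢.ae_mem _ _ (Θ.push_aeeq h) hφ
  comp_mem := fun φ ψ hφ hψ =>
    𝒢.ae_mem _ _ (Θ.push_comp φ ψ).symm (𝒢.comp_mem _ _ hφ hψ)
  inv_mem := fun φ hφ => 𝒢.ae_mem _ _ (Θ.push_inv φ).symm (𝒢.inv_mem _ hφ)
  id_mem := fun S hS => by
    refine 𝒢.ae_mem _ _ (LocalIso.AEEq.symm ?_)
      (𝒢.id_mem (Θ.push (LocalIso.idOn μ S hS)).source (Θ.push _).measurableSet_source)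
    refine ⟨Filter.EventuallyEq.rfl, Eventually.of_forall fun y hy => ?_⟩
    exact Θ.right_inv' hy.1
  glue := fun φ R hR hd hu h => by
    have hm : ∀ n, MeasurableSet ((Θ.push φ).source ∩ Θ.invFun ⁻¹' R n) := fun n =>
      (Θ.push φ).measurableSet_source.inter (Θ.measurable_invFun (hR n))
    refine 𝒢.glue (Θ.push φ) (fun n => (Θ.push φ).source ∩ Θ.invFun ⁻¹' R n) hm ?_ ?_ ?_
    · intro i j hij
      exact ((hd hij).preimage Θ.invFun).mono inter_subset_right inter_subset_right
    · rw [← inter_iUnion, ← preimage_iUnion, hu]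
      refine inter_eq_left.2 fun y hy => hy.2.1
    · intro n
      refine 𝒢.ae_mem _ _ ?_ (h n)
      refine ⟨Eventually.of_forall fun y => propext ?_, Eventually.of_forall fun y _ => rfl⟩
      constructor
      · rintro ⟨a, ⟨b, b'⟩, c⟩
        exact ⟨⟨⟨a, b', c⟩, b⟩, ⟨a, b', c⟩⟩
      · rintro ⟨⟨⟨a, b', c⟩, b⟩, -⟩
        exact ⟨a, ⟨b, b'⟩, c⟩

/-- The cocycle `φ ↦ Θ⁻¹ (w (Θ φ Θ⁻¹))` of `ℋ`, for `w` a cocycle of `𝒢` and `Θ ℋ Θ⁻¹ ⊆ 𝒢`. -/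
def Z1.pullback {ν : Measure Y} {𝒢 : FullGroupoid ν} (w : Z1 𝒢) (Θ : Embed μ ν)
    (ℋ : FullGroupoid μ) (h : ∀ φ ∈ ℋ.carrier, Θ.push φ ∈ 𝒢.carrier) : Z1 ℋ where
  val := fun φ => Θ.pull (w.val ⟨Θ.push φ.1, h _ φ.2⟩)
  congr := fun φ ψ hφψ => 
    congrArg Θ.pull (w.congr ⟨_, h _ φ.2⟩ ⟨_, h _ ψ.2⟩ (Θ.push_aeeq hφψ))
  range := fun φ => by rw [← Θ.pull_star, ← Θ.pull_mul, w.range, Θ.pull_chi]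
  cocycle := fun φ ψ => by
    rw [← Θ.pull_act, ← Θ.pull_mul, ← w.cocycle]
    exact congrArg Θ.pull (w.congr _ _ (Θ.push_comp φ.1 ψ.1))

/-- Isomorphism of full groupoids: an isomorphism `Θ`, modulo null sets, of the underlying
probability spaces with `Θ 𝒢 Θ⁻¹ = ℋ`.  (Between probability spaces the rescaling constant in
`Embed` is `1` as soon as the range of `Θ` is conull.) -/
def FullGroupoid.IsIso {ν : Measure Y} (𝒢 : FullGroupoid μ) (ℋ : FullGroupoid ν) : Prop :=
  ∃ Θ : Embed μ ν, ν Θ.targetᶜ = 0 ∧ ∀ φ, φ ∈ 𝒢.carrier ↔ Θ.push φ ∈ ℋ.carrier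

/-- The inclusion in `(X, μ)` of the measurable subset `S` with its normalized measure
`μ(· ∩ S)/μ(S)`.  This probability space is written as `X` with the conditional measure
`μ(· | S)`, for which the complement of `S` is a null set. -/
def Embed.ofSubset (μ : Measure X) [IsFiniteMeasure μ] (S : Set X) (hS : MeasurableSet S) :
    Embed (ProbabilityTheory.cond μ S) μ where
  toPartialEquiv := PartialEquiv.ofSet S
  measurable_toFun := measurable_id
  measurable_invFun := measurable_id
  measurableSet_source := hS
  measurableSet_target := hS
  source_conull := by
    change ProbabilityTheory.cond μ S Sᶜ = 0
    rw [ProbabilityTheory.cond_apply hS]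
    simp
  measure_image := by
    by_cases h0 : μ S = 0
    · refine ⟨1, one_ne_zero, ENNReal.one_ne_top, fun E hE hsub => ?_⟩
      change E ⊆ S at hsub
      change μ (id '' E) = _
      rw [image_id, ProbabilityTheory.cond_apply hS, inter_eq_right.2 hsub,
        measure_mono_null hsub h0]
      simp
    · refine ⟨μ S, h0, measure_ne_top μ S, fun E hE hsub => ?_⟩
      change E ⊆ S at hsub
      change μ (id '' E) = _
      rw [image_id, ProbabilityTheory.cond_apply hS, inter_eq_right.2 hsub, ← mul_assoc,
        ENNReal.mul_inv_cancel h0 (measure_ne_top μ S), one_mul]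

/-- The restriction of the full groupoid `𝒢` to the measurable subset `S`, with its normalized
measure. -/
def FullGroupoid.restrict [IsFiniteMeasure μ] (𝒢 : FullGroupoid μ) (S : Set X)
    (hS : MeasurableSet S) : FullGroupoid (ProbabilityTheory.cond μ S) :=
  𝒢.pullback (Embed.ofSubset μ S hS)

/-- The restriction of a cocycle of `𝒢` to a cocycle of the restriction of `𝒢` to `S`. -/
def Z1.restrict [IsFiniteMeasure μ] {𝒢 : FullGroupoid μ} (w : Z1 𝒢) (S : Set X)
    (hS : MeasurableSet S) : Z1 (𝒢.restrict S hS) :=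
  w.pullback (Embed.ofSubset μ S hS) _ (fun _ h => h)

/-- The uniform probability measure on `n` points. -/
abbrev unif (n : ℕ) : Measure (Fin n) := ProbabilityTheory.uniformOn univ

/-- The full groupoid on `X × {1, …, n}` generated by `𝒢 × 𝒟_n`, where `𝒟_n` consists of all
measure preserving local isomorphisms of the `n`-point probability space. -/
def FullGroupoid.matrix [SFinite μ] (𝒢 : FullGroupoid μ) (n : ℕ) :
    FullGroupoid (μ.prod (unif n)) :=
  FullGroupoid.generate {ψ | ∃ φ ∈ 𝒢.carrier, ∃ d : LocalIso (unif n), ψ = φ.prod d}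

/-- `ℋ` is isomorphic to the amplification `𝒢^t`: for some integer `n ≥ t`, it is isomorphic to the
restriction of the full groupoid generated by `𝒢 × 𝒟_n` to a subset of measure `t / n`. -/
def FullGroupoid.IsAmplification {ν : Measure Y} [IsFiniteMeasure ν] (ℋ : FullGroupoid μ)
    (𝒢 : FullGroupoid ν) (t : ℝ) : Prop :=
  ∃ (n : ℕ) (S : Set (Y × Fin n)) (hS : MeasurableSet S), t ≤ n ∧
    (ν.prod (unif n)) S = ENNReal.ofReal (t / n) ∧ ℋ.IsIso ((𝒢.matrix n).restrict S hS)

/-- The inclusion `x ↦ (x, i)` of `X` in `X × {1, …, n}`. -/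
def Embed.slice (μ : Measure X) [SFinite μ] (n : ℕ) (i : Fin n) :
    Embed μ (μ.prod (unif n)) where
  toFun := fun x => (x, i)
  invFun := Prod.fst
  source := univ
  target := univ ×ˢ {i}
  map_source' := by simp
  map_target' := by simp
  left_inv' := by simp
  right_inv' := by
    rintro ⟨x, j⟩ h
    have : j = i := by simpa using h
    simp [this]
  measurable_toFun := measurable_prodMk_right
  measurable_invFun := measurable_fst
  measurableSet_source := MeasurableSet.univ
  measurableSet_target := MeasurableSet.univ.prod (measurableSet_singleton i)
  source_conull := by simp
  measure_image := by
    have : Nonempty (Fin n) := ⟨i⟩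
    refine ⟨unif n {i}, ?_, measure_ne_top _ _, fun E hE _ => ?_⟩
    · simp [unif, ProbabilityTheory.uniformOn, ProbabilityTheory.cond_apply]
    · have : (fun x : X => (x, i)) '' E = E ×ˢ {i} := by
        rw [prod_singleton]
      rw [this, Measure.prod_prod, mul_comm]

theorem FullGroupoid.slice_mem [SFinite μ] (𝒢 : FullGroupoid μ) (n : ℕ) (i : Fin n)
    (φ : LocalIso μ) (hφ : φ ∈ 𝒢.carrier) :
    (Embed.slice μ n i).push φ ∈ (𝒢.matrix n).carrier := by
  refine (𝒢.matrix n).ae_mem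
    (φ.prod (LocalIso.idOn (unif n) {i} (measurableSet_singleton i))) _ ?_
    (FullGroupoid.subset_generate _ ⟨φ, hφ, _, rfl⟩)
  constructor
  · refine Eventually.of_forall fun y => propext ?_
    constructor
    · rintro ⟨a, b⟩
      exact ⟨⟨trivial, b⟩, a, trivial⟩
    · rintro ⟨⟨-, b⟩, a, -⟩
      exact ⟨a, b⟩
  · refine Eventually.of_forall fun y hy => ?_
    have h : y.2 = i := hy.2
    change (φ y.1, y.2) = (φ y.1, i)
    rw [h]

/-- The restriction of a cocycle of the full groupoid generated by `𝒢 × 𝒟_n` to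
`𝒢 ≃ 𝒢 × {id_i}`. -/
def Z1.slice [SFinite μ] {𝒢 : FullGroupoid μ} {n : ℕ} (w : Z1 (𝒢.matrix n)) (i : Fin n) : Z1 𝒢 :=
  w.pullback (Embed.slice μ n i) 𝒢 (𝒢.slice_mem n i)

/-! ### Group actions -/

section Action

variable (G : Type*) [Group G] [MulAction G X] [MeasurableConstSMul G X]

/-- The local isomorphism `x ↦ g • x`. -/
def LocalIso.ofSMul (μ : Measure X) [SMulInvariantMeasure G X μ] (g : G) : LocalIso μ where
  toPartialEquiv := (MulAction.toPerm g : Equiv.Perm X).toPartialEquiv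
  measurable_toFun := measurable_const_smul g
  measurable_invFun := measurable_const_smul g⁻¹
  measurableSet_source := MeasurableSet.univ
  measurableSet_target := MeasurableSet.univ
  measure_image := by
    intro E _ _
    exact measure_smul μ g E

/-- Freeness: every `g ≠ 1` acts without fixed points, modulo null sets. -/
def IsFreeAction (μ : Measure X) : Prop := ∀ g : G, g ≠ 1 → ∀ᵐ x ∂μ, g • x ≠ x

/-- The full groupoid `𝒢_σ` of an action of a countable group: the local isomorphisms `φ` such that
`φ x` lies in the orbit of `x` for almost every `x` in the domain; as the group is countable, this
means that `φ` agrees with group elements on the pieces of a countable measurable partition. -/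
def orbitGroupoid (μ : Measure X) [SMulInvariantMeasure G X μ] : FullGroupoid μ where
  carrier := {φ | ∀ᵐ x ∂μ, x ∈ φ.source → ∃ g : G, φ x = g • x}
  ae_mem := by
    intro φ ψ h hφ
    filter_upwards [hφ, h.1.mem_iff, h.2] with x h1 h2 h3 hx
    obtain ⟨g, hg⟩ := h1 (h2.2 hx)
    exact ⟨g, by rw [← h3 (h2.2 hx), hg]⟩
  comp_mem := by
    intro φ ψ hφ hψ
    filter_upwards [hψ, ψ.ae_comp hφ] with x h1 h2 hx
    obtain ⟨g, hg⟩ := h1 hx.1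
    obtain ⟨k, hk⟩ := h2 hx.1 hx.2
    refine ⟨k * g, ?_⟩
    rw [mul_smul, ← hg, ← hk]
    rfl
  inv_mem := by
    intro φ hφ
    filter_upwards [φ.ae_comp_inv hφ] with x h1 hx
    obtain ⟨g, hg⟩ := h1 hx (φ.map_target' hx)
    rw [φ.right_inv' hx] at hg
    exact ⟨g⁻¹, eq_inv_smul_iff.2 hg.symm⟩
  id_mem := by
    intro S hS
    change ∀ᵐ x ∂μ, x ∈ S → ∃ g : G, x = g • x
    exact Eventually.of_forall fun x _ => ⟨1, (one_smul G x).symm⟩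
  glue := by
    intro φ R hR _ hu h
    filter_upwards [ae_all_iff.2 h] with x hx hxs
    rw [← hu] at hxs
    obtain ⟨n, hn⟩ := mem_iUnion.1 hxs
    exact hx n ⟨hn, hu ▸ mem_iUnion.2 ⟨n, hn⟩⟩

theorem ofSMul_mem (μ : Measure X) [SMulInvariantMeasure G X μ] (g : G) :
    LocalIso.ofSMul G μ g ∈ (orbitGroupoid G μ).carrier := by
  change ∀ᵐ x ∂μ, x ∈ univ → ∃ k : G, g • x = k • x
  exact Eventually.of_forall fun _ _ => ⟨g, rfl⟩

/-- The automorphism `σ_g(u) = u ∘ g⁻¹` of `𝒰(A)`. -/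
def sigma {G : Type*} [Group G] [MulAction G X] [MeasurableConstSMul G X]
    [SMulInvariantMeasure G X μ] (g : G) (u : X →ₘ[μ] Circle) : X →ₘ[μ] Circle :=
  u.compMeasurePreserving (fun x => g⁻¹ • x) (measurePreserving_smul g⁻¹ μ)

theorem sigma_mul {G : Type*} [Group G] [MulAction G X] [MeasurableConstSMul G X]
    [SMulInvariantMeasure G X μ] (g : G) (u v : X →ₘ[μ] Circle) :
    sigma g (u * v) = sigma g u * sigma g v := by
  induction u using AEEqFun.induction_on
  induction v using AEEqFun.induction_on
  rfl

theorem sigma_inv {G : Type*} [Group G] [MulAction G X] [MeasurableConstSMul G X]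
    [SMulInvariantMeasure G X μ] (g : G) (u : X →ₘ[μ] Circle) :
    sigma g u⁻¹ = (sigma g u)⁻¹ := by
  induction u using AEEqFun.induction_on
  rfl

theorem sigma_one {G : Type*} [Group G] [MulAction G X] [MeasurableConstSMul G X]
    [SMulInvariantMeasure G X μ] (g : G) :
    sigma g (1 : X →ₘ[μ] Circle) = 1 := rfl

/-- The group `Z¹(σ)` of `1`-cocycles of the action, as a subgroup of `𝒰(A)^G`. -/
def cocycles (μ : Measure X) [SMulInvariantMeasure G X μ] : Subgroup (G → X →ₘ[μ] Circle) where
  carrier := {w | ∀ g h, w (g * h) = w g * sigma g (w h)}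
  mul_mem' := by
    intro w w' hw hw' g h
    simp only [Pi.mul_apply]
    rw [hw, hw', sigma_mul, mul_mul_mul_comm]
  one_mem' := fun g h => by simp [sigma_one]
  inv_mem' := by
    intro w hw g h
    simp only [Pi.inv_apply]
    rw [hw, sigma_inv, mul_inv]

/-- The group `Z¹(σ)`; its topology is the one of pointwise convergence in `‖·‖₂`. -/
def ActZ1 (μ : Measure X) [SMulInvariantMeasure G X μ] : Type _ := cocycles G μ

instance (μ : Measure X) [SMulInvariantMeasure G X μ] : CommGroup (ActZ1 G μ) :=
  inferInstanceAs (CommGroup (cocycles G μ))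

instance (μ : Measure X) [SMulInvariantMeasure G X μ] [IsFiniteMeasure μ] :
    TopologicalSpace (ActZ1 G μ) :=
  TopologicalSpace.induced
    (fun (w : ActZ1 G μ) (g : G) => toL2 (toC (w.1 g)) (ae_norm_toC_le _)) Pi.topologicalSpace

/-- The coboundaries `w_g = u^* σ_g(u)`, `u ∈ 𝒰(A)`. -/
def ActB1 (μ : Measure X) [SMulInvariantMeasure G X μ] : Subgroup (ActZ1 G μ) where
  carrier := {w | ∃ u : X →ₘ[μ] Circle, ∀ g, w.1 g = u⁻¹ * sigma g u}
  mul_mem' := by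
    rintro w w' ⟨u, hu⟩ ⟨v, hv⟩
    refine ⟨u * v, fun g => ?_⟩
    change w.1 g * w'.1 g = _
    rw [hu, hv, sigma_mul, mul_inv, mul_mul_mul_comm]
  one_mem' := by
    refine ⟨1, fun g => ?_⟩
    change 1 = _
    rw [sigma_one, inv_one, one_mul]
  inv_mem' := by
    rintro w ⟨u, hu⟩
    refine ⟨u⁻¹, fun g => ?_⟩
    change (w.1 g)⁻¹ = _
    rw [hu, sigma_inv, mul_inv]

/-- The first cohomology group `H¹(σ) = Z¹(σ) / B¹(σ)`, with its quotient topology. -/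
abbrev ActH1 (μ : Measure X) [SMulInvariantMeasure G X μ] : Type _ := ActZ1 G μ ⧸ ActB1 G μ

end Action

variable (G H : Type*) [Group G] [MulAction G X] [MeasurableConstSMul G X]
  [Group H] [MulAction H Y] [MeasurableConstSMul H Y]

/-- Orbit equivalence: an isomorphism of probability spaces, modulo null sets, which takes almost
every orbit onto an orbit. -/
def OrbitEquivalent (μ : Measure X) (ν : Measure Y) : Prop :=
  ∃ Ψ : Embed μ ν, ν Ψ.targetᶜ = 0 ∧
    ∀ᵐ x ∂μ, Ψ '' MulAction.orbit G x = MulAction.orbit H (Ψ x)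

/-- Stable orbit equivalence: `𝒢_σ ≃ (𝒢_ρ)^t` for some `t > 0`. -/
def StablyOrbitEquivalent (μ : Measure X) [SMulInvariantMeasure G X μ]
    (ν : Measure Y) [IsFiniteMeasure ν] [SMulInvariantMeasure H Y ν] : Prop :=
  ∃ t : ℝ, 0 < t ∧ (orbitGroupoid G μ).IsAmplification (orbitGroupoid H ν) t

end FullGpd

end

open FullGpd

/-!
A cocycle `w` of a full groupoid is a function of germs: for almost every `y`, the value `w_φ(y)`
depends only on the point `φ⁻¹ y` (`Z1.ae_germ`).  This turns all the statements into pointwise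
ones, in which only countably many elements of the groupoid are involved at a time.

Let `Θ` be an isomorphism of `(X, μ)` onto a subset of `(Y, ν)`, let `𝒦` be a full groupoid on
`(Y, ν)` and `ℋ = Θ⁻¹ 𝒦 Θ`.  Suppose that countably many elements `τ_k` of `𝒦`, with domains in the
range of `Θ`, have ranges covering `Y` (a `Sweep`).  A measurable choice of `k` sends `y` to a base
point `Θ⁻¹ τ_k⁻¹ y` in `X`, and a germ of `𝒦` from `z` to `y` to a germ of `ℋ` between the base
points.  Evaluating a cocycle of `ℋ` on the latter extends it to `𝒦` (`Sweep.extend`), and this is a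
section of the restriction map `Z¹(𝒦) → Z¹(ℋ)`.  The section is continuous because
`‖·‖₂`-convergence of functions bounded by one can be tested on the pieces of a countable partition
(`tendsto_lintegral_of_cover`).  A cocycle of `𝒦` whose restriction is a coboundary is one itself,
a trivializing unitary being carried from the base points to `Y` by the values `w_{τ_k}`.  Hence
restriction induces an isomorphism `H¹(𝒦) ≃ H¹(ℋ)` of topological groups (`Sweep.exists_H1_equiv`),
and already `Z¹(𝒦) ≃ Z¹(ℋ)` when the range of `Θ` is conull (`exists_Z1_equiv`).

If `𝒦` is ergodic, an exhaustion argument provides a sweeping by any non-null set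
(`FullGroupoid.Ergodic.nonempty_sweep`).  The amplification `𝒦_n` of an ergodic `𝒢` is ergodic, and
its restriction to each slice is `𝒢`; the latter holds because the local isomorphisms all of whose
corners lie in `𝒢` form a full groupoid containing the generators of `𝒦_n`
(`FullGroupoid.matrix_subset_cornerGroupoid`).  So `H¹(𝒢)` and `H¹(𝒦_n|_S)` are both identified with
`H¹(𝒦_n)`, and the identification does not depend on the slice, since different slices are
conjugate by an element of `𝒦_n` (`FullGroupoid.mk_slice_eq`).

For a free action almost every germ of the orbit groupoid is the germ of a unique group element, so
that a cocycle of the orbit groupoid is determined by, and can be reconstructed from, its values on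
the group (`actZ1Equiv`).  The invariance under (stable) orbit equivalence follows by combining
these isomorphisms.
-/

noncomputable section

namespace FullGpd

/-! ### Cocycles as functions of germs -/

section Germs

variable {X : Type*} [MeasurableSpace X] {μ : Measure X}

namespace LocalIso

theorem mem_comp_target (φ ψ : LocalIso μ) (y : X) :
    y ∈ (φ.comp ψ).target ↔ y ∈ φ.target ∧ φ.invFun y ∈ ψ.target := by
  change y ∈ (ψ.toPartialEquiv.trans φ.toPartialEquiv).target ↔ _
  rw [PartialEquiv.trans_target]
  rfl

theorem AEEq.invFun {φ ψ : LocalIso μ} (h : φ.AEEq ψ) :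
    ∀ᵐ y ∂μ, y ∈ φ.target → φ.invFun y = ψ.invFun y := by
  filter_upwards [φ.ae_comp_inv h.1.mem_iff, φ.ae_comp_inv h.2] with y h1 h2 hy
  have hs := φ.map_target' hy
  have h3 := h2 hy hs
  have h4 : ψ.invFun (ψ (φ.invFun y)) = φ.invFun y := ψ.left_inv' ((h1 hy).1 hs)
  rw [← h3, φ.right_inv' hy] at h4
  exact h4.symm

/-- Almost everywhere equality may be tested on the inverses. -/
theorem AEEq.of_inv {φ ψ : LocalIso μ} (h1 : ∀ᵐ y ∂μ, y ∈ φ.target ↔ y ∈ ψ.target)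
    (h2 : ∀ᵐ y ∂μ, y ∈ φ.target → φ.invFun y = ψ.invFun y) : φ.AEEq ψ := by
  have h : φ.inv.AEEq ψ.inv := ⟨h1.mono fun y hy => propext hy, h2⟩
  exact ⟨h.target, h.invFun⟩

end LocalIso

namespace FullGroupoid

/-- The composition of two elements of a full groupoid. -/
def mulElt {𝒢 : FullGroupoid μ} (φ ψ : 𝒢.carrier) : 𝒢.carrier :=
  ⟨φ.1.comp ψ.1, 𝒢.comp_mem _ _ φ.2 ψ.2⟩

/-- Membership in a full groupoid is inherited by a local isomorphism which agrees almost
everywhere with a restriction. -/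
theorem mem_of_restr (𝒢 : FullGroupoid μ) {φ ψ : LocalIso μ} (hφ : φ ∈ 𝒢.carrier)
    (h : ∀ᵐ x ∂μ, x ∈ ψ.source → x ∈ φ.source ∧ φ x = ψ x) : ψ ∈ 𝒢.carrier := by
  refine 𝒢.ae_mem (φ.restr ψ.source ψ.measurableSet_source) ψ ⟨?_, ?_⟩
    (𝒢.comp_mem _ _ hφ (𝒢.id_mem _ _))
  · filter_upwards [h] with x hx
    exact propext ⟨fun h => h.1, fun h => ⟨h, (hx h).1⟩⟩
  · filter_upwards [h] with x hx h
    exact (hx h.1).2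

end FullGroupoid

namespace Z1

variable {𝒢 : FullGroupoid μ}

theorem ae_norm_eq_one (w : Z1 𝒢) (φ : 𝒢.carrier) :
    ∀ᵐ y ∂μ, y ∈ φ.1.target → ‖w.val φ y‖ = 1 := by
  have h := w.range φ
  filter_upwards [AEEqFun.coeFn_mul (w.val φ) (star (w.val φ)), AEEqFun.coeFn_star (w.val φ),
    coeFn_chi (μ := μ) φ.1.target φ.1.measurableSet_target] with x h1 h2 h3 hx
  rw [h, h3, Pi.mul_apply, h2, Pi.star_apply, indicator_of_mem hx] at h1
  have := congrArg norm h1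
  rw [norm_mul, norm_star, norm_one] at this
  nlinarith [norm_nonneg (w.val φ x)]

theorem ae_conj_mul_self (w : Z1 𝒢) (φ : 𝒢.carrier) :
    ∀ᵐ y ∂μ, y ∈ φ.1.target → conj (w.val φ y) * w.val φ y = 1 := by
  filter_upwards [w.ae_norm_eq_one φ] with y hy h
  rw [Complex.conj_mul', hy h]; simp

theorem ae_eq_zero (w : Z1 𝒢) (φ : 𝒢.carrier) :
    ∀ᵐ y ∂μ, y ∉ φ.1.target → w.val φ y = 0 := by
  have h := w.chi_mul_val φ
  filter_upwards [AEEqFun.coeFn_mul (chi μ φ.1.target φ.1.measurableSet_target) (w.val φ),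
    coeFn_chi (μ := μ) φ.1.target φ.1.measurableSet_target] with x h1 h2 hx
  rw [h, Pi.mul_apply, h2, indicator_of_notMem hx, zero_mul] at h1
  exact h1

/-- The cocycle identity at almost every point. -/
theorem ae_comp (w : Z1 𝒢) (φ ψ : 𝒢.carrier) : ∀ᵐ y ∂μ, y ∈ φ.1.target →
    w.val (FullGroupoid.mulElt φ ψ) y = w.val φ y * w.val ψ (φ.1.invFun y) := by
  have h := w.cocycle φ ψ
  filter_upwards [AEEqFun.coeFn_mul (w.val φ) (φ.1.act (w.val ψ)), φ.1.coeFn_act (w.val ψ)]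
    with y h1 h2 hy
  rw [← h, Pi.mul_apply, h2, indicator_of_mem hy] at h1
  exact h1

theorem eq_of_ae {w w' : Z1 𝒢}
    (h : ∀ φ : 𝒢.carrier, ∀ᵐ y ∂μ, y ∈ φ.1.target → w.val φ y = w'.val φ y) : w = w' := by
  ext1
  funext φ
  apply AEEqFun.ext
  filter_upwards [h φ, w.ae_eq_zero φ, w'.ae_eq_zero φ] with y h1 h2 h3
  by_cases hy : y ∈ φ.1.target
  · exact h1 hy
  · rw [h2 hy, h3 hy]

/-- The cocycle on an identity is one on its domain. -/
theorem ae_idOn (w : Z1 𝒢) (S : Set X) (hS : MeasurableSet S) :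
    ∀ᵐ y ∂μ, y ∈ S → w.val ⟨LocalIso.idOn μ S hS, 𝒢.id_mem S hS⟩ y = 1 := by
  set e : 𝒢.carrier := ⟨LocalIso.idOn μ S hS, 𝒢.id_mem S hS⟩ with he
  have h1 : w.val (FullGroupoid.mulElt e e) = w.val e := by
    refine w.congr _ _ ⟨Eventually.of_forall fun y => propext ?_,
      Eventually.of_forall fun _ _ => rfl⟩
    exact ⟨fun h => h.1, fun h => ⟨h, h⟩⟩
  filter_upwards [w.ae_comp e e, w.ae_conj_mul_self e] with y h2 h3 hy
  have h4 := h2 hy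
  rw [h1] at h4
  have h5 : w.val e y = w.val e y * w.val e y := h4
  calc w.val e y = (conj (w.val e y) * w.val e y) * w.val e y := by rw [h3 hy, one_mul]
    _ = conj (w.val e y) * (w.val e y * w.val e y) := by ring
    _ = 1 := by rw [← h5, h3 hy]

/-- The value `w_φ(y)` only depends on the germ of `φ` at `φ⁻¹ y`. -/
theorem ae_germ [MeasurableEq X] (w : Z1 𝒢) (φ ψ : 𝒢.carrier) : ∀ᵐ y ∂μ, y ∈ φ.1.target →
    y ∈ ψ.1.target → φ.1.invFun y = ψ.1.invFun y → w.val φ y = w.val ψ y := by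
  have hT : MeasurableSet ((φ.1.target ∩ ψ.1.target) ∩ {y | φ.1.invFun y = ψ.1.invFun y}) :=
    (φ.1.measurableSet_target.inter ψ.1.measurableSet_target).inter
      (measurableSet_eq_fun φ.1.measurable_invFun ψ.1.measurable_invFun)
  set T := (φ.1.target ∩ ψ.1.target) ∩ {y | φ.1.invFun y = ψ.1.invFun y} with hTd
  set e : 𝒢.carrier := ⟨LocalIso.idOn μ T hT, 𝒢.id_mem T hT⟩
  have h1 : w.val (FullGroupoid.mulElt e φ) = w.val (FullGroupoid.mulElt e ψ) := by
    refine w.congr _ _ (LocalIso.AEEq.of_inv (Eventually.of_forall fun y => ?_)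
      (Eventually.of_forall fun y hy => ?_))
    · change y ∈ (e.1.comp φ.1).target ↔ y ∈ (e.1.comp ψ.1).target
      rw [LocalIso.mem_comp_target, LocalIso.mem_comp_target]
      exact ⟨fun h => ⟨h.1, h.1.1.2⟩, fun h => ⟨h.1, h.1.1.1⟩⟩
    · have hy' := ((LocalIso.mem_comp_target e.1 φ.1 y).1 hy).1
      exact hy'.2
  filter_upwards [w.ae_comp e φ, w.ae_comp e ψ, w.ae_idOn T hT] with y h2 h3 h4 ha hb hc
  have hy : y ∈ T := ⟨⟨ha, hb⟩, hc⟩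
  have h5 := h2 hy
  have h6 := h3 hy
  rw [h4 hy, one_mul] at h5 h6
  rw [h1] at h5
  exact h5.symm.trans h6

/-- A cocycle given by pointwise values, which matter only on the ranges. -/
def ofFun (𝒢 : FullGroupoid μ) (f : 𝒢.carrier → X → ℂ) (hm : ∀ φ, Measurable (f φ))
    (hcongr : ∀ φ ψ : 𝒢.carrier, φ.1.AEEq ψ.1 → ∀ᵐ y ∂μ, y ∈ φ.1.target → f φ y = f ψ y)
    (hnorm : ∀ φ : 𝒢.carrier, ∀ᵐ y ∂μ, y ∈ φ.1.target → ‖f φ y‖ = 1)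
    (hcomp : ∀ φ ψ : 𝒢.carrier, ∀ᵐ y ∂μ, y ∈ φ.1.target → φ.1.invFun y ∈ ψ.1.target →
      f (FullGroupoid.mulElt φ ψ) y = f φ y * f ψ (φ.1.invFun y)) : Z1 𝒢 where
  val := fun φ => AEEqFun.mk (φ.1.target.indicator (f φ))
    ((hm φ).indicator φ.1.measurableSet_target).aestronglyMeasurable
  congr := by
    intro φ ψ h
    apply AEEqFun.mk_eq_mk.2
    filter_upwards [h.target.mem_iff, hcongr φ ψ h] with y h1 h2
    by_cases hy : y ∈ φ.1.target
    · rw [indicator_of_mem hy, indicator_of_mem (h1.1 hy), h2 hy]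
    · rw [indicator_of_notMem hy, indicator_of_notMem (fun h => hy (h1.2 h))]
  range := by
    intro φ
    set F := AEEqFun.mk (μ := μ) (φ.1.target.indicator (f φ))
      ((hm φ).indicator φ.1.measurableSet_target).aestronglyMeasurable
    apply AEEqFun.ext
    filter_upwards [AEEqFun.coeFn_mul F (star F), AEEqFun.coeFn_star F, hnorm φ,
      coeFn_chi (μ := μ) φ.1.target φ.1.measurableSet_target,
      AEEqFun.coeFn_mk (μ := μ) (φ.1.target.indicator (f φ))
        ((hm φ).indicator φ.1.measurableSet_target).aestronglyMeasurable] with y h1 h2 h3 h4 h5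
    rw [h1, h4, Pi.mul_apply, h2, Pi.star_apply, h5]
    by_cases hy : y ∈ φ.1.target
    · rw [indicator_of_mem hy, indicator_of_mem hy]
      change f φ y * conj (f φ y) = 1
      rw [Complex.mul_conj', h3 hy]; simp
    · rw [indicator_of_notMem hy, indicator_of_notMem hy, zero_mul]
  cocycle := by
    intro φ ψ
    set F := AEEqFun.mk (μ := μ) (φ.1.target.indicator (f φ))
      ((hm φ).indicator φ.1.measurableSet_target).aestronglyMeasurable
    set G := AEEqFun.mk (μ := μ) (ψ.1.target.indicator (f ψ))
      ((hm ψ).indicator ψ.1.measurableSet_target).aestronglyMeasurable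
    have hG := AEEqFun.coeFn_mk (μ := μ) (ψ.1.target.indicator (f ψ))
        ((hm ψ).indicator ψ.1.measurableSet_target).aestronglyMeasurable
    apply AEEqFun.ext
    filter_upwards [AEEqFun.coeFn_mul F (φ.1.act G), φ.1.coeFn_act G, φ.1.ae_comp_inv hG,
      AEEqFun.coeFn_mk (μ := μ) (φ.1.target.indicator (f φ))
        ((hm φ).indicator φ.1.measurableSet_target).aestronglyMeasurable,
      AEEqFun.coeFn_mk (μ := μ) ((FullGroupoid.mulElt φ ψ).1.target.indicator
        (f (FullGroupoid.mulElt φ ψ))) ((hm _).indicator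
          (FullGroupoid.mulElt φ ψ).1.measurableSet_target).aestronglyMeasurable,
      hcomp φ ψ] with y h1 h2 h3 h4 h5 h6
    rw [h1, Pi.mul_apply, h2, h4]
    refine h5.trans ?_
    have ht : y ∈ (FullGroupoid.mulElt φ ψ).1.target ↔ _ := LocalIso.mem_comp_target φ.1 ψ.1 y
    by_cases hy : y ∈ φ.1.target
    · rw [indicator_of_mem hy, indicator_of_mem hy, h3 hy]
      by_cases hz : φ.1.invFun y ∈ ψ.1.target
      · rw [indicator_of_mem (ht.2 ⟨hy, hz⟩), indicator_of_mem hz, h6 hy hz]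
      · rw [indicator_of_notMem (fun h => hz (ht.1 h).2), indicator_of_notMem hz, mul_zero]
    · rw [indicator_of_notMem hy, indicator_of_notMem (fun h => hy (ht.1 h).1), zero_mul]

theorem ofFun_val (f : 𝒢.carrier → X → ℂ) (hm) (hcongr) (hnorm) (hcomp) (φ : 𝒢.carrier) :
    ∀ᵐ y ∂μ, y ∈ φ.1.target → (ofFun 𝒢 f hm hcongr hnorm hcomp).val φ y = f φ y := by
  filter_upwards [AEEqFun.coeFn_mk (μ := μ) (φ.1.target.indicator (f φ))
        ((hm φ).indicator φ.1.measurableSet_target).aestronglyMeasurable] with y h hy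
  refine h.trans ?_
  rw [indicator_of_mem hy]

end Z1

/-- A measurable function of modulus one almost everywhere defines a unitary of `L^∞`. -/
theorem exists_toC_eq {u : X → ℂ} (hu : Measurable u) (h1 : ∀ᵐ x ∂μ, ‖u x‖ = 1) :
    ∃ v : X →ₘ[μ] Circle, ∀ᵐ x ∂μ, toC v x = u x := by
  refine ⟨AEEqFun.mk (fun x => Circle.exp (Complex.arg (u x)))
    (Circle.exp.continuous.comp_aestronglyMeasurable
      (Complex.measurable_arg.comp hu).aestronglyMeasurable), ?_⟩
  filter_upwards [h1, coeFn_toC (AEEqFun.mk (μ := μ) (fun x => Circle.exp (Complex.arg (u x)))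
    (Circle.exp.continuous.comp_aestronglyMeasurable
      (Complex.measurable_arg.comp hu).aestronglyMeasurable)),
    AEEqFun.coeFn_mk (μ := μ) (fun x => Circle.exp (Complex.arg (u x)))
    (Circle.exp.continuous.comp_aestronglyMeasurable
      (Complex.measurable_arg.comp hu).aestronglyMeasurable)] with x h2 h3 h4
  rw [h3, h4, Circle.coe_exp]
  have := Complex.norm_mul_exp_arg_mul_I (u x)
  rwa [h2, Complex.ofReal_one, one_mul] at this

theorem ae_norm_toC (u : X →ₘ[μ] Circle) : ∀ᵐ x ∂μ, ‖toC u x‖ = 1 := by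
  filter_upwards [coeFn_toC u] with x hx
  rw [hx]; exact Circle.norm_coe _

theorem toC_injective : Function.Injective (toC : (X →ₘ[μ] Circle) → X →ₘ[μ] ℂ) := by
  intro u v h
  apply AEEqFun.ext
  filter_upwards [coeFn_toC u, coeFn_toC v] with x h1 h2
  apply Circle.ext
  rw [← h1, ← h2, h]

/-- Coboundaries, pointwise: `w_φ(y) = conj (u y) * u (φ⁻¹ y)`. -/
theorem mem_B1_iff {𝒢 : FullGroupoid μ} {w : Z1 𝒢} : w ∈ B1 𝒢 ↔ ∃ u : X → ℂ, Measurable u ∧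
    (∀ᵐ x ∂μ, ‖u x‖ = 1) ∧ ∀ φ : 𝒢.carrier, ∀ᵐ y ∂μ, y ∈ φ.1.target →
      w.val φ y = conj (u y) * u (φ.1.invFun y) := by
  constructor
  · rintro ⟨u, hu⟩
    refine ⟨toC u, (toC u).measurable, ae_norm_toC u, fun φ => ?_⟩
    rw [hu φ]
    filter_upwards [AEEqFun.coeFn_mul (star (toC u)) (φ.1.act (toC u)),
      AEEqFun.coeFn_star (toC u), φ.1.coeFn_act (toC u)] with y h1 h2 h3 hy
    rw [h1, Pi.mul_apply, h2, h3, indicator_of_mem hy]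
    rfl
  · rintro ⟨u, hm, h1, hu⟩
    obtain ⟨v, hv⟩ := exists_toC_eq hm h1
    refine ⟨v, fun φ => ?_⟩
    apply AEEqFun.ext
    filter_upwards [AEEqFun.coeFn_mul (star (toC v)) (φ.1.act (toC v)),
      AEEqFun.coeFn_star (toC v), φ.1.coeFn_act (toC v), hu φ, w.ae_eq_zero φ, hv,
      φ.1.ae_comp_inv hv] with y h1 h2 h3 h4 h5 h6 h7
    rw [h1, Pi.mul_apply, h2, h3]
    by_cases hy : y ∈ φ.1.target
    · rw [indicator_of_mem hy, h4 hy, h7 hy, Pi.star_apply, h6]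
      rfl
    · rw [indicator_of_notMem hy, h5 hy, mul_zero]

end Germs

/-! ### Convergence in `‖·‖₂` of functions bounded by one -/

section Topology

variable {X Y : Type*} [MeasurableSpace X] [MeasurableSpace Y] {μ : Measure X} {ν : Measure Y}

theorem tendsto_toL2_iff [IsFiniteMeasure μ] {ι : Type*} {l : Filter ι} (F : ι → X →ₘ[μ] ℂ)
    (hF : ∀ t, ∀ᵐ x ∂μ, ‖F t x‖ ≤ 1) (g : X →ₘ[μ] ℂ) (hg : ∀ᵐ x ∂μ, ‖g x‖ ≤ 1) :
    Tendsto (fun t => toL2 (F t) (hF t)) l (𝓝 (toL2 g hg)) ↔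
      Tendsto (fun t => ∫⁻ x, ‖F t x - g x‖ₑ ^ 2 ∂μ) l (𝓝 0) := by
  have h1 : ∀ t, eLpNorm (⇑(F t) - ⇑g) 2 μ ^ 2 = ∫⁻ x, ‖F t x - g x‖ₑ ^ 2 ∂μ := by
    intro t
    have := eLpNorm_nnreal_pow_eq_lintegral (μ := μ) (f := ⇑(F t) - ⇑g) (p := 2) two_ne_zero
    simpa using this
  refine (Lp.tendsto_Lp_iff_tendsto_eLpNorm'' (fun t => ⇑(F t)) _ (⇑g) _).trans ?_
  simp_rw [← h1]
  constructor
  · intro h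
    simpa [Function.comp_def] using ((ENNReal.continuous_pow 2).tendsto 0).comp h
  · intro h
    have h2 := (ENNReal.continuous_rpow_const (y := (1 / 2 : ℝ))).tendsto 0 |>.comp h
    rw [ENNReal.zero_rpow_of_pos (by norm_num)] at h2
    refine h2.congr fun t => ?_
    simp only [Function.comp_apply]
    rw [← ENNReal.rpow_natCast, ← ENNReal.rpow_mul]
    norm_num

theorem Z1.continuous_iff [IsFiniteMeasure μ] {𝒢 : FullGroupoid μ} {T : Type*}
    [TopologicalSpace T] (F : T → Z1 𝒢) : Continuous F ↔ ∀ φ t₀,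
      Tendsto (fun t => ∫⁻ x, ‖(F t).val φ x - (F t₀).val φ x‖ₑ ^ 2 ∂μ) (𝓝 t₀) (𝓝 0) := by
  rw [continuous_induced_rng, continuous_pi_iff]
  refine forall_congr' fun φ => ?_
  rw [continuous_iff_continuousAt]
  exact forall_congr' fun t₀ => tendsto_toL2_iff _ (fun t => (F t).ae_norm_le φ) _
    ((F t₀).ae_norm_le φ)

theorem Z1.tendsto_val [IsFiniteMeasure μ] {𝒢 : FullGroupoid μ} (φ : 𝒢.carrier) (w₀ : Z1 𝒢) :
    Tendsto (fun w : Z1 𝒢 => ∫⁻ x, ‖w.val φ x - w₀.val φ x‖ₑ ^ 2 ∂μ) (𝓝 w₀) (𝓝 0) :=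
  (Z1.continuous_iff (fun w : Z1 𝒢 => w)).1 continuous_id φ w₀

/-- Convergence of integrals may be checked on the members of a countable cover, for uniformly
bounded functions on a finite measure space. -/
theorem tendsto_lintegral_of_cover [IsFiniteMeasure μ] {ι κ : Type*} [Countable κ] {l : Filter ι}
    (D : ι → X → ℝ≥0∞) {C : ℝ≥0∞} (hC : C ≠ ∞) (hD : ∀ t, ∀ᵐ x ∂μ, D t x ≤ C) (A : κ → Set X)
    (hA : ∀ k, MeasurableSet (A k)) (hcov : ∀ᵐ x ∂μ, ∃ k, x ∈ A k)
    (h : ∀ k, Tendsto (fun t => ∫⁻ x in A k, D t x ∂μ) l (𝓝 0)) :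
    Tendsto (fun t => ∫⁻ x, D t x ∂μ) l (𝓝 0) := by
  cases isEmpty_or_nonempty κ with
  | inl hκ =>
    have : ∀ t, ∫⁻ x, D t x ∂μ = 0 := by
      intro t
      have : ∀ᵐ x ∂μ, D t x = 0 := by
        filter_upwards [hcov] with x hx
        obtain ⟨k, -⟩ := hx
        exact isEmptyElim k
      rw [lintegral_congr_ae this, lintegral_zero]
    simp_rw [this]
    exact tendsto_const_nhds
  | inr hκ =>
    obtain ⟨e, he⟩ := exists_surjective_nat κ
    -- `B N` is what the first `N` members of the cover miss; its measure tends to zero.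
    set B : ℕ → Set X := fun N => (⋃ n ∈ Finset.range N, A (e n))ᶜ with hB
    have hBm : ∀ N, MeasurableSet (B N) := fun N =>
      (Finset.measurableSet_biUnion _ fun n _ => hA _).compl
    have hanti : Antitone B := by
      intro M N hMN
      refine compl_subset_compl.2 (biUnion_subset_biUnion_left fun n hn => ?_)
      exact Finset.mem_range.2 ((Finset.mem_range.1 hn).trans_le hMN)
    have hlim := tendsto_measure_iInter_atTop (μ := μ) (fun N => (hBm N).nullMeasurableSet) hanti
      ⟨0, measure_ne_top _ _⟩
    have hnull : μ (⋂ N, B N) = 0 := by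
      refine measure_mono_null ?_ (ae_iff.1 hcov)
      rintro x hx ⟨k, hk⟩
      obtain ⟨n, rfl⟩ := he k
      refine mem_iInter.1 hx (n + 1) (mem_biUnion (x := n) ?_ hk)
      exact Finset.mem_coe.2 (Finset.self_mem_range_succ n)
    rw [hnull] at hlim
    rw [ENNReal.tendsto_nhds_zero]
    intro ε hε
    have hlim2 : Tendsto (fun N => C * μ (B N)) atTop (𝓝 0) := by
      simpa using ENNReal.Tendsto.const_mul hlim (Or.inr hC)
    obtain ⟨N, hN⟩ := (ENNReal.tendsto_nhds_zero.1 hlim2 (ε / 2)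
      (ENNReal.half_pos hε.ne')).exists
    have hsum : Tendsto (fun t => ∑ n ∈ Finset.range N, ∫⁻ x in A (e n), D t x ∂μ) l (𝓝 0) := by
      simpa using tendsto_finsetSum (Finset.range N) fun n _ => h (e n)
    filter_upwards [ENNReal.tendsto_nhds_zero.1 hsum (ε / 2) (ENNReal.half_pos hε.ne')] with t ht
    calc ∫⁻ x, D t x ∂μ = ∫⁻ x in B N, D t x ∂μ + ∫⁻ x in (B N)ᶜ, D t x ∂μ :=
          (lintegral_add_compl _ (hBm N)).symm
      _ ≤ C * μ (B N) + ∑ n ∈ Finset.range N, ∫⁻ x in A (e n), D t x ∂μ := by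
          gcongr
          · calc ∫⁻ x in B N, D t x ∂μ ≤ ∫⁻ x in B N, C ∂μ :=
                  lintegral_mono_ae (ae_restrict_of_ae (hD t))
              _ = C * μ (B N) := by rw [setLIntegral_const]
          · rw [hB, compl_compl]
            have := lintegral_iUnion_le (μ := μ) (fun n : Finset.range N => A (e n)) (D t)
            rw [tsum_fintype, Finset.sum_coe_sort (Finset.range N)
              (fun n => ∫⁻ x in A (e n), D t x ∂μ)] at this
            rwa [iUnion_subtype] at this
      _ ≤ ε / 2 + ε / 2 := add_le_add hN ht
      _ = ε := ENNReal.add_halves ε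

theorem ae_enorm_sub_sq_le {f g : X → ℂ} (hf : ∀ᵐ x ∂μ, ‖f x‖ ≤ 1) (hg : ∀ᵐ x ∂μ, ‖g x‖ ≤ 1) :
    ∀ᵐ x ∂μ, ‖f x - g x‖ₑ ^ 2 ≤ 4 := by
  filter_upwards [hf, hg] with x h1 h2
  have h3 : ‖f x - g x‖ₑ ≤ 2 := by
    rw [← ofReal_norm, show (2 : ℝ≥0∞) = ENNReal.ofReal 2 by simp]
    exact ENNReal.ofReal_le_ofReal ((norm_sub_le _ _).trans (by linarith))
  calc ‖f x - g x‖ₑ ^ 2 ≤ 2 ^ 2 := by gcongr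
    _ = 4 := by norm_num

theorem LocalIso.lintegral_invFun (φ : LocalIso μ) {g : X → ℝ≥0∞} (hg : Measurable g) :
    ∫⁻ y in φ.target, g (φ.invFun y) ∂μ = ∫⁻ x in φ.source, g x ∂μ := by
  have h := φ.inv.measurePreserving
  exact h.lintegral_comp hg

theorem Embed.exists_lintegral_invFun (Θ : Embed μ ν) : ∃ c : ℝ≥0∞, c ≠ 0 ∧ c ≠ ∞ ∧
    ∀ g : X → ℝ≥0∞, Measurable g → ∫⁻ y in Θ.target, g (Θ.invFun y) ∂ν = c * ∫⁻ x, g x ∂μ := by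
  obtain ⟨c, hc0, hct, hc⟩ := Θ.measure_image
  refine ⟨c, hc0, hct, fun g hg => ?_⟩
  have hmap : Measure.map Θ.invFun (ν.restrict Θ.target) = c • μ := by
    ext E hE
    rw [Measure.map_apply Θ.measurable_invFun hE, Measure.restrict_apply (Θ.measurable_invFun hE),
      Measure.smul_apply, smul_eq_mul]
    have h1 := hc (E ∩ Θ.source) (hE.inter Θ.measurableSet_source) inter_subset_right
    have h2 : Θ '' (E ∩ Θ.source) = Θ.invFun ⁻¹' E ∩ Θ.target := by
      ext y
      constructor
      · rintro ⟨x, ⟨hx, hs⟩, rfl⟩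
        refine ⟨?_, Θ.map_source' hs⟩
        rw [mem_preimage, Θ.left_inv' hs]
        exact hx
      · rintro ⟨hy, ht⟩
        exact ⟨Θ.invFun y, ⟨hy, Θ.map_target' ht⟩, Θ.right_inv' ht⟩
    rw [← h2, h1]
    congr 1
    refine measure_congr ?_
    filter_upwards [Θ.ae_source] with x hx
    exact propext ⟨fun h => h.1, fun h => ⟨h, hx⟩⟩
  rw [← lintegral_map hg Θ.measurable_invFun, hmap, lintegral_smul_measure, smul_eq_mul]

theorem Embed.exists_lintegral_comp_le (Θ : Embed μ ν) : ∃ c : ℝ≥0∞, c ≠ ∞ ∧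
    ∀ g : Y → ℝ≥0∞, Measurable g → ∫⁻ x, g (Θ x) ∂μ ≤ c * ∫⁻ y, g y ∂ν := by
  obtain ⟨c, hc0, hct, hc⟩ := Θ.exists_lintegral_invFun
  refine ⟨c⁻¹, ENNReal.inv_ne_top.2 hc0, fun g hg => ?_⟩
  have h1 : ∫⁻ y in Θ.target, g (Θ (Θ.invFun y)) ∂ν = ∫⁻ y in Θ.target, g y ∂ν :=
    setLIntegral_congr_fun Θ.measurableSet_target fun y hy => congrArg g (Θ.right_inv' hy)
  have h2 := hc (fun x => g (Θ x)) (hg.comp Θ.measurable_toFun)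
  calc ∫⁻ x, g (Θ x) ∂μ = c⁻¹ * (c * ∫⁻ x, g (Θ x) ∂μ) := by
        rw [← mul_assoc, ENNReal.inv_mul_cancel hc0 hct, one_mul]
    _ = c⁻¹ * ∫⁻ y in Θ.target, g y ∂ν := by rw [← h2, h1]
    _ ≤ c⁻¹ * ∫⁻ y, g y ∂ν := by gcongr; exact Measure.restrict_le_self

/-- The restriction of cocycles along `Θ`, as a homomorphism. -/
def Z1.pullbackHom {𝒦 : FullGroupoid ν} (Θ : Embed μ ν) (ℋ : FullGroupoid μ)
    (h : ∀ φ ∈ ℋ.carrier, Θ.push φ ∈ 𝒦.carrier) : Z1 𝒦 →* Z1 ℋ :=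
  MonoidHom.mk' (fun w => w.pullback Θ ℋ h) fun a b => by
    ext1; funext φ; exact Θ.pull_mul _ _

theorem Z1.pullback_val {𝒦 : FullGroupoid ν} (Θ : Embed μ ν) (ℋ : FullGroupoid μ)
    (h : ∀ φ ∈ ℋ.carrier, Θ.push φ ∈ 𝒦.carrier) (w : Z1 𝒦) (φ : ℋ.carrier) :
    ∀ᵐ x ∂μ, (w.pullback Θ ℋ h).val φ x = w.val ⟨Θ.push φ.1, h _ φ.2⟩ (Θ x) :=
  Θ.coeFn_pull _

theorem Z1.continuous_pullback [IsFiniteMeasure μ] [IsFiniteMeasure ν] {𝒦 : FullGroupoid ν}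
    (Θ : Embed μ ν) (ℋ : FullGroupoid μ) (h : ∀ φ ∈ ℋ.carrier, Θ.push φ ∈ 𝒦.carrier) :
    Continuous fun w : Z1 𝒦 => w.pullback Θ ℋ h := by
  rw [Z1.continuous_iff]
  intro φ w₀
  obtain ⟨c, hc, hle⟩ := Θ.exists_lintegral_comp_le
  set ψ : 𝒦.carrier := ⟨Θ.push φ.1, h _ φ.2⟩ with hψ
  have hlim : Tendsto (fun w : Z1 𝒦 => c * ∫⁻ y, ‖w.val ψ y - w₀.val ψ y‖ₑ ^ 2 ∂ν)
      (𝓝 w₀) (𝓝 0) := by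
    simpa using ENNReal.Tendsto.const_mul (Z1.tendsto_val ψ w₀) (Or.inr hc)
  refine tendsto_of_tendsto_of_tendsto_of_le_of_le tendsto_const_nhds hlim
    (fun _ => zero_le) fun w => ?_
  refine le_trans (le_of_eq (lintegral_congr_ae ?_)) (hle (fun y => ‖w.val ψ y - w₀.val ψ y‖ₑ ^ 2)
    (((w.val ψ).measurable.sub (w₀.val ψ).measurable).enorm.pow_const 2))
  filter_upwards [Z1.pullback_val Θ ℋ h w φ, Z1.pullback_val Θ ℋ h w₀ φ] with x h1 h2
  rw [h1, h2]

end Topology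

/-! ### Restriction to a subset which meets every orbit -/

/-- A continuous homomorphism with a continuous section, under which the given normal subgroups
correspond, induces an isomorphism of the quotients, as topological groups. -/
theorem exists_quotient_equiv {A B : Type*} [CommGroup A] [CommGroup B] [TopologicalSpace A]
    [TopologicalSpace B] (N : Subgroup A) (M : Subgroup B) (f : A →* B) (hf : Continuous f)
    (g : B → A) (hg : Continuous g) (hfg : ∀ b, f (g b) = b) (hNM : ∀ a, a ∈ N ↔ f a ∈ M) :
    ∃ Φ : A ⧸ N ≃ₜ* B ⧸ M, ∀ a : A, Φ (QuotientGroup.mk a) = QuotientGroup.mk (f a) := by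
  set F : A ⧸ N →* B ⧸ M := QuotientGroup.map N M f fun a ha => (hNM a).1 ha with hF
  have hFmk : ∀ a : A, F (QuotientGroup.mk a) = QuotientGroup.mk (f a) := fun a => rfl
  have hbij : Function.Bijective F := by
    constructor
    · rw [injective_iff_map_eq_one]
      intro q hq
      obtain ⟨a, rfl⟩ := QuotientGroup.mk_surjective q
      rw [hFmk, QuotientGroup.eq_one_iff] at hq
      exact (QuotientGroup.eq_one_iff a).2 ((hNM a).2 hq)
    · intro q
      obtain ⟨b, rfl⟩ := QuotientGroup.mk_surjective q
      exact ⟨QuotientGroup.mk (g b), by rw [hFmk, hfg]⟩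
  set e : A ⧸ N ≃* B ⧸ M := MulEquiv.ofBijective F hbij
  have hsymm : ∀ b : B, e.symm (QuotientGroup.mk b) = QuotientGroup.mk (g b) := by
    intro b
    rw [MulEquiv.symm_apply_eq]
    change _ = F (QuotientGroup.mk (g b))
    rw [hFmk, hfg]
  refine ⟨{ e with
    continuous_toFun := ?_
    continuous_invFun := ?_ }, hFmk⟩
  · refine continuous_quot_lift _ ?_
    exact continuous_quot_mk.comp hf
  · refine (isQuotientMap_quot_mk (r := (QuotientGroup.leftRel M).r)).continuous_iff.2 ?_
    have h : Continuous fun b : B => (QuotientGroup.mk (g b) : A ⧸ N) :=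
      continuous_quot_mk.comp hg
    exact h.congr fun b => (hsymm b).symm

section Sweep

variable {X Y : Type*} [MeasurableSpace X] [MeasurableSpace Y] {μ : Measure X} {ν : Measure Y}

namespace Embed

/-- Two embeddings which rescale the measure by the same constant. -/
def SameScale (Θ Θ' : Embed μ ν) : Prop := ∃ c : ℝ≥0∞, c ≠ 0 ∧ c ≠ ∞ ∧
  (∀ E, MeasurableSet E → E ⊆ Θ.source → ν (Θ '' E) = c * μ E) ∧
    ∀ E, MeasurableSet E → E ⊆ Θ'.source → ν (Θ' '' E) = c * μ E

theorem SameScale.refl (Θ : Embed μ ν) : Θ.SameScale Θ := by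
  obtain ⟨c, h0, h1, h⟩ := Θ.measure_image
  exact ⟨c, h0, h1, h, h⟩

/-- The corner `Θ'⁻¹ ψ Θ` of a local isomorphism `ψ` of `(Y, ν)`, as a local isomorphism of
`(X, μ)`. -/
def corner (Θ Θ' : Embed μ ν) (hΘ : Θ.SameScale Θ') (ψ : LocalIso ν) : LocalIso μ where
  toPartialEquiv := Θ.toPartialEquiv.trans (ψ.toPartialEquiv.trans Θ'.toPartialEquiv.symm)
  measurable_toFun := Θ'.measurable_invFun.comp (ψ.measurable_toFun.comp Θ.measurable_toFun)
  measurable_invFun := Θ.measurable_invFun.comp (ψ.measurable_invFun.comp Θ'.measurable_toFun)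
  measurableSet_source := by
    rw [PartialEquiv.trans_source, PartialEquiv.trans_source]
    exact Θ.measurableSet_source.inter (Θ.measurable_toFun
      (ψ.measurableSet_source.inter (ψ.measurable_toFun Θ'.measurableSet_target)))
  measurableSet_target := by
    rw [PartialEquiv.trans_target, PartialEquiv.trans_target]
    refine MeasurableSet.inter (Θ'.measurableSet_source.inter
      (Θ'.measurable_toFun ψ.measurableSet_target)) ?_
    exact (ψ.measurable_invFun.comp Θ'.measurable_toFun) Θ.measurableSet_target
  measure_image := by
    intro E hE hsub
    rw [PartialEquiv.trans_source, PartialEquiv.trans_source] at hsub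
    obtain ⟨c, hc0, hct, hc, hc'⟩ := hΘ
    have hEs : E ⊆ Θ.source := fun x hx => (hsub hx).1
    have hF : Θ '' E ⊆ ψ.source := by
      rintro _ ⟨x, hx, rfl⟩; exact (hsub hx).2.1
    have hFm := Θ.measurableSet_image hE hEs
    have hG : ψ '' (Θ '' E) ⊆ Θ'.target := by
      rintro _ ⟨_, ⟨x, hx, rfl⟩, rfl⟩; exact (hsub hx).2.2
    have hGm := ψ.measurableSet_image hFm hF
    have hH : Θ'.invFun '' (ψ '' (Θ '' E)) = Θ'.source ∩ Θ' ⁻¹' (ψ '' (Θ '' E)) :=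
      Θ'.toPartialEquiv.symm_image_eq_source_inter_preimage hG
    have hHm : MeasurableSet (Θ'.invFun '' (ψ '' (Θ '' E))) := by
      rw [hH]; exact Θ'.measurableSet_source.inter (Θ'.measurable_toFun hGm)
    have hHs : Θ'.invFun '' (ψ '' (Θ '' E)) ⊆ Θ'.source := by rw [hH]; exact inter_subset_left
    have hback : Θ' '' (Θ'.invFun '' (ψ '' (Θ '' E))) = ψ '' (Θ '' E) :=
      Θ'.toPartialEquiv.image_symm_image_of_subset_target hG
    have h1 := hc' _ hHm hHs
    rw [hback, ψ.measure_image _ hFm hF, hc _ hE hEs] at h1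
    have h2 := (ENNReal.mul_right_inj hc0 hct).1 h1
    rw [h2, image_image, image_image]
    rfl

theorem mem_corner_source {Θ Θ' : Embed μ ν} (hΘ : Θ.SameScale Θ') (ψ : LocalIso ν) (x : X) :
    x ∈ (Θ.corner Θ' hΘ ψ).source ↔ x ∈ Θ.source ∧ Θ x ∈ ψ.source ∧ ψ (Θ x) ∈ Θ'.target :=
  Iff.rfl

theorem mem_corner_target {Θ Θ' : Embed μ ν} (hΘ : Θ.SameScale Θ') (ψ : LocalIso ν) (x : X) :
    x ∈ (Θ.corner Θ' hΘ ψ).target ↔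
      x ∈ Θ'.source ∧ Θ' x ∈ ψ.target ∧ ψ.invFun (Θ' x) ∈ Θ.target := by
  change x ∈ (Θ.toPartialEquiv.trans (ψ.toPartialEquiv.trans Θ'.toPartialEquiv.symm)).target ↔ _
  rw [PartialEquiv.trans_target, PartialEquiv.trans_target]
  exact and_assoc

theorem corner_apply {Θ Θ' : Embed μ ν} (hΘ : Θ.SameScale Θ') (ψ : LocalIso ν) (x : X) :
    Θ.corner Θ' hΘ ψ x = Θ'.invFun (ψ (Θ x)) := rfl

theorem corner_invFun {Θ Θ' : Embed μ ν} (hΘ : Θ.SameScale Θ') (ψ : LocalIso ν) (x : X) :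
    (Θ.corner Θ' hΘ ψ).invFun x = Θ.invFun (ψ.invFun (Θ' x)) := rfl

theorem push_corner_mem {𝒦 : FullGroupoid ν} {Θ : Embed μ ν} {ψ : LocalIso ν}
    (hψ : ψ ∈ 𝒦.carrier) : Θ.push (Θ.corner Θ (.refl Θ) ψ) ∈ 𝒦.carrier := by
  refine 𝒦.mem_of_restr hψ (Eventually.of_forall fun y hy => ?_)
  obtain ⟨h1, h5, h4⟩ := (Θ.mem_push_source _ y).1 hy
  obtain ⟨-, h2, h3⟩ := (mem_corner_source _ _ _).1 h5
  have e : Θ (Θ.invFun y) = y := Θ.right_inv' h1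
  rw [e] at h2 h3
  refine ⟨h2, ?_⟩
  rw [push_apply, corner_apply, e]
  exact (Θ.right_inv' h3).symm

end Embed

/-- A sweeping of `(Y, ν)` by the range of `Θ`: countably many elements `τ k` of `𝒦`, with domains
inside the range of `Θ`, and a measurable choice `index y`, for almost every `y`, of one of them
which takes a point of the range of `Θ` to `y`.  For `y` in the range of `Θ` this point has to be
`y` itself. -/
structure Sweep (𝒦 : FullGroupoid ν) (Θ : Embed μ ν) where
  τ : ℕ → 𝒦.carrier
  index : Y → ℕ
  measurable_index : Measurable index
  mem_target : ∀ᵐ y ∂ν, y ∈ (τ (index y)).1.target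
  source_subset : ∀ k, (τ k).1.source ⊆ Θ.target
  eq_self : ∀ᵐ y ∂ν, y ∈ Θ.target → (τ (index y)).1.invFun y = y

namespace Sweep

variable {𝒦 : FullGroupoid ν} {Θ : Embed μ ν} {ℋ : FullGroupoid μ} (s : Sweep 𝒦 Θ)

/-- The sweeping by a conull range: the identity. -/
def ofConull (𝒦 : FullGroupoid ν) (Θ : Embed μ ν) (h : ν Θ.targetᶜ = 0) : Sweep 𝒦 Θ where
  τ := fun _ => ⟨LocalIso.idOn ν Θ.target Θ.measurableSet_target, 𝒦.id_mem _ _⟩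
  index := fun _ => 0
  measurable_index := measurable_const
  mem_target := ae_iff.2 h
  source_subset := fun _ => Subset.rfl
  eq_self := Eventually.of_forall fun _ _ => rfl

/-- The base point in `X` of `y`. -/
def base (y : Y) : X := Θ.invFun ((s.τ (s.index y)).1.invFun y)

theorem measurable_base : Measurable s.base := by
  have h : Measurable fun q : ℕ × Y => Θ.invFun ((s.τ q.1).1.invFun q.2) :=
    measurable_from_prod_countable_right fun k =>
      Θ.measurable_invFun.comp (s.τ k).1.measurable_invFun
  exact h.comp (s.measurable_index.prodMk measurable_id)

theorem ae_base {p : X → Prop} (h : ∀ᵐ x ∂μ, p x) : ∀ᵐ y ∂ν, p (s.base y) := by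
  filter_upwards [ae_all_iff.2 fun k => (s.τ k).1.ae_comp_inv (Θ.ae_comp_inv h), s.mem_target]
    with y h1 h2
  exact h1 _ h2 (s.source_subset _ ((s.τ _).1.map_target' h2))

theorem ae_base_comp : ∀ᵐ x ∂μ, s.base (Θ x) = x := by
  filter_upwards [Θ.ae_source, Θ.ae_comp s.eq_self] with x h1 h2
  rw [base, h2 (Θ.map_source' h1), Θ.left_inv' h1]

/-- The element `Θ⁻¹ τ_k⁻¹ φ τ_l Θ` of `ℋ`. -/
def piece (hℋ : ∀ φ, φ ∈ ℋ.carrier ↔ Θ.push φ ∈ 𝒦.carrier) (k l : ℕ) (φ : 𝒦.carrier) :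
    ℋ.carrier :=
  ⟨Θ.corner Θ (.refl Θ) ((s.τ k).1.inv.comp (φ.1.comp (s.τ l).1)), (hℋ _).2
    (Embed.push_corner_mem (𝒦.comp_mem _ _ (𝒦.inv_mem _ (s.τ k).2)
      (𝒦.comp_mem _ _ φ.2 (s.τ l).2)))⟩

variable (hℋ : ∀ φ, φ ∈ ℋ.carrier ↔ Θ.push φ ∈ 𝒦.carrier)

/-- The piece of `φ` at `y` takes the base point of `φ⁻¹ y` to that of `y`. -/
theorem piece_germ {φ : 𝒦.carrier} {y : Y} (hy : y ∈ φ.1.target)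
    (h1 : y ∈ (s.τ (s.index y)).1.target)
    (h2 : φ.1.invFun y ∈ (s.τ (s.index (φ.1.invFun y))).1.target) :
    s.base y ∈ (s.piece hℋ (s.index y) (s.index (φ.1.invFun y)) φ).1.target ∧
      (s.piece hℋ (s.index y) (s.index (φ.1.invFun y)) φ).1.invFun (s.base y) =
        s.base (φ.1.invFun y) := by
  set k := s.index y
  set l := s.index (φ.1.invFun y) with hl
  have a1 : (s.τ k).1.invFun y ∈ Θ.target := s.source_subset _ ((s.τ k).1.map_target' h1)
  have a2 : Θ (s.base y) = (s.τ k).1.invFun y := Θ.right_inv' a1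
  have a3 : (s.τ k).1 ((s.τ k).1.invFun y) = y := (s.τ k).1.right_inv' h1
  have a4 : (s.τ l).1.invFun (φ.1.invFun y) ∈ Θ.target :=
    s.source_subset _ ((s.τ l).1.map_target' h2)
  constructor
  · refine (Embed.mem_corner_target (.refl Θ) _ _).2 ⟨Θ.map_target' a1, ?_, ?_⟩
    · rw [a2, LocalIso.mem_comp_target, LocalIso.mem_comp_target]
      refine ⟨(s.τ k).1.map_target' h1, ?_⟩
      change (s.τ k).1 ((s.τ k).1.invFun y) ∈ φ.1.target ∧
        φ.1.invFun ((s.τ k).1 ((s.τ k).1.invFun y)) ∈ (s.τ l).1.target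
      rw [a3]
      exact ⟨hy, h2⟩
    · rw [a2]
      change (s.τ l).1.invFun (φ.1.invFun ((s.τ k).1 ((s.τ k).1.invFun y))) ∈ Θ.target
      rwa [a3]
  · change Θ.invFun ((s.τ l).1.invFun (φ.1.invFun ((s.τ k).1 (Θ (s.base y))))) = _
    rw [a2, a3]
    rfl

/-- The pointwise values of the extension to `𝒦` of a cocycle `w` of `ℋ`: the value at `y` is that
of `w` on the germ from the base point of `φ⁻¹ y` to the base point of `y`. -/
def extFun (w : Z1 ℋ) (φ : 𝒦.carrier) (y : Y) : ℂ :=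
  w.val (s.piece hℋ (s.index y) (s.index (φ.1.invFun y)) φ) (s.base y)

theorem measurable_extFun (w : Z1 ℋ) (φ : 𝒦.carrier) : Measurable (s.extFun hℋ w φ) := by
  have h1 : Measurable fun q : (ℕ × ℕ) × Y => w.val (s.piece hℋ q.1.1 q.1.2 φ) (s.base q.2) :=
    measurable_from_prod_countable_right fun k =>
      (w.val (s.piece hℋ k.1 k.2 φ)).measurable.comp s.measurable_base
  have h2 : Measurable fun y : Y => ((s.index y, s.index (φ.1.invFun y)), y) :=
    (s.measurable_index.prodMk (s.measurable_index.comp φ.1.measurable_invFun)).prodMk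
      measurable_id
  have h := h1.comp h2
  simp only [Function.comp_def] at h
  exact h

theorem ae_mem_piece (φ : 𝒦.carrier) : ∀ᵐ y ∂ν, y ∈ φ.1.target →
    s.base y ∈ (s.piece hℋ (s.index y) (s.index (φ.1.invFun y)) φ).1.target ∧
      (s.piece hℋ (s.index y) (s.index (φ.1.invFun y)) φ).1.invFun (s.base y) =
        s.base (φ.1.invFun y) := by
  filter_upwards [s.mem_target, φ.1.ae_comp_inv s.mem_target] with y h1 h2 hy
  exact s.piece_germ hℋ hy h1 (h2 hy)

theorem ae_extFun [MeasurableEq X] (w : Z1 ℋ) (φ : 𝒦.carrier) (α : ℋ.carrier) :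
    ∀ᵐ y ∂ν, y ∈ φ.1.target → s.base y ∈ α.1.target →
      α.1.invFun (s.base y) = s.base (φ.1.invFun y) →
        s.extFun hℋ w φ y = w.val α (s.base y) := by
  filter_upwards [s.ae_mem_piece hℋ φ,
    ae_all_iff.2 fun k => ae_all_iff.2 fun l => s.ae_base (w.ae_germ (s.piece hℋ k l φ) α)]
    with y h1 h2 hy ha hb
  obtain ⟨h3, h4⟩ := h1 hy
  exact h2 _ _ h3 ha (h4.trans hb.symm)

/-- The extension to `𝒦` of a cocycle of `ℋ`. -/
def extend [MeasurableEq X] (w : Z1 ℋ) : Z1 𝒦 := by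
  refine Z1.ofFun 𝒦 (s.extFun hℋ w) (s.measurable_extFun hℋ w) ?_ ?_ ?_
  · intro φ ψ h
    filter_upwards [s.ae_mem_piece hℋ ψ, ae_all_iff.2 fun k => ae_all_iff.2 fun l =>
      s.ae_extFun hℋ w φ (s.piece hℋ k l ψ), h.target.mem_iff, h.invFun] with y h1 h2 h3 h4 hy
    obtain ⟨h5, h6⟩ := h1 (h3.1 hy)
    refine h2 _ _ hy h5 ?_
    rw [h6, h4 hy]
  · intro φ
    filter_upwards [s.ae_mem_piece hℋ φ, ae_all_iff.2 fun k => ae_all_iff.2 fun l =>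
      s.ae_base (w.ae_norm_eq_one (s.piece hℋ k l φ))] with y h1 h2 hy
    exact h2 _ _ (h1 hy).1
  · intro φ ψ
    filter_upwards [s.ae_mem_piece hℋ φ, φ.1.ae_comp_inv (s.ae_mem_piece hℋ ψ),
      ae_all_iff.2 fun k => ae_all_iff.2 fun l => ae_all_iff.2 fun m => ae_all_iff.2 fun n =>
        s.ae_extFun hℋ w (FullGroupoid.mulElt φ ψ)
          (FullGroupoid.mulElt (s.piece hℋ k l φ) (s.piece hℋ m n ψ)),
      ae_all_iff.2 fun k => ae_all_iff.2 fun l => ae_all_iff.2 fun m => ae_all_iff.2 fun n =>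
        s.ae_base (w.ae_comp (s.piece hℋ k l φ) (s.piece hℋ m n ψ))]
      with y h1 h2 h3 h4 hy hz
    obtain ⟨h5, h6⟩ := h1 hy
    obtain ⟨h7, h8⟩ := h2 hy hz
    set α := s.piece hℋ (s.index y) (s.index (φ.1.invFun y)) φ with hα
    set β := s.piece hℋ (s.index (φ.1.invFun y)) (s.index (ψ.1.invFun (φ.1.invFun y))) ψ with hβ
    have h9 : s.base y ∈ (FullGroupoid.mulElt α β).1.target := by
      refine (LocalIso.mem_comp_target α.1 β.1 _).2 ⟨h5, ?_⟩
      rw [h6]; exact h7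
    have h10 : (FullGroupoid.mulElt α β).1.invFun (s.base y) =
        s.base ((FullGroupoid.mulElt φ ψ).1.invFun y) := by
      change β.1.invFun (α.1.invFun (s.base y)) = _
      rw [h6, h8]
      rfl
    have h11 := h3 _ _ _ _ ((LocalIso.mem_comp_target φ.1 ψ.1 y).2 ⟨hy, hz⟩) h9 h10
    rw [h11]
    refine (h4 _ _ _ _ h5).trans ?_
    rw [h6]
    rfl

theorem extend_val [MeasurableEq X] (w : Z1 ℋ) (φ : 𝒦.carrier) : ∀ᵐ y ∂ν, y ∈ φ.1.target →
    (s.extend hℋ w).val φ y = s.extFun hℋ w φ y :=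
  Z1.ofFun_val _ _ _ _ _ φ

theorem pullback_extend [MeasurableEq X] (w : Z1 ℋ) :
    (s.extend hℋ w).pullback Θ ℋ (fun φ hφ => (hℋ φ).1 hφ) = w := by
  refine Z1.eq_of_ae fun φ => ?_
  set ψ : 𝒦.carrier := ⟨Θ.push φ.1, (hℋ _).1 φ.2⟩ with hψ
  filter_upwards [Z1.pullback_val Θ ℋ (fun φ hφ => (hℋ φ).1 hφ) (s.extend hℋ w) φ,
    Θ.ae_comp (s.extend_val hℋ w ψ), Θ.ae_comp (s.ae_extFun hℋ w ψ φ), Θ.mem_push_target_ae φ.1,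
    s.ae_base_comp, φ.1.ae_comp_inv s.ae_base_comp, Θ.ae_source] with x h1 h2 h3 h4 h5 h6 h7 hx
  have h8 := h4.2 hx
  have h9 : ψ.1.invFun (Θ x) = Θ (φ.1.invFun x) := by
    change Θ (φ.1.invFun (Θ.invFun (Θ x))) = _
    rw [Θ.left_inv' h7]
  rw [h1, h2 h8, h3 h8 (by rwa [h5]) (by rw [h5, h9, h6 hx]), h5]

theorem continuous_extend [MeasurableEq X] [IsFiniteMeasure μ] [IsFiniteMeasure ν] :
    Continuous (s.extend hℋ) := by
  rw [Z1.continuous_iff]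
  intro φ w₀
  -- The cover: off the range of `φ` there is nothing to prove; on the range, the pieces on which
  -- the indices of `y` and `φ⁻¹ y` are given.
  set A : Option (ℕ × ℕ) → Set Y := fun o => o.elim φ.1.targetᶜ fun q =>
    φ.1.target ∩ ((s.τ q.1).1.target ∩ {y | s.index y = q.1 ∧ s.index (φ.1.invFun y) = q.2}) with hA
  have hm1 : ∀ k, MeasurableSet {y | s.index y = k} := fun k =>
    s.measurable_index (measurableSet_singleton k)
  refine tendsto_lintegral_of_cover _ (C := 4) (by norm_num)
    (fun w => ae_enorm_sub_sq_le ((s.extend hℋ w).ae_norm_le φ) ((s.extend hℋ w₀).ae_norm_le φ))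
    A ?_ ?_ ?_
  · rintro (_ | ⟨k, l⟩)
    · exact φ.1.measurableSet_target.compl
    · exact φ.1.measurableSet_target.inter ((s.τ k).1.measurableSet_target.inter
        ((hm1 k).inter (φ.1.measurable_invFun (hm1 l))))
  · filter_upwards [s.mem_target] with y h1
    by_cases hy : y ∈ φ.1.target
    · exact ⟨some (s.index y, s.index (φ.1.invFun y)), hy, h1, rfl, rfl⟩
    · exact ⟨none, hy⟩
  · rintro (_ | ⟨k, l⟩)
    · have : ∀ w, ∫⁻ y in A none, ‖(s.extend hℋ w).val φ y - (s.extend hℋ w₀).val φ y‖ₑ ^ 2 ∂ν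
          = 0 := by
        intro w
        rw [← lintegral_zero (μ := ν.restrict (A none))]
        refine setLIntegral_congr_fun_ae φ.1.measurableSet_target.compl ?_
        filter_upwards [(s.extend hℋ w).ae_eq_zero φ, (s.extend hℋ w₀).ae_eq_zero φ]
          with y h1 h2 hy
        rw [h1 hy, h2 hy]
        simp
      simp_rw [this]
      exact tendsto_const_nhds
    · obtain ⟨c, -, hc, hint⟩ := Θ.exists_lintegral_invFun
      set α := s.piece hℋ k l φ with hα
      have hlim : Tendsto (fun w : Z1 ℋ => c * ∫⁻ x, ‖w.val α x - w₀.val α x‖ₑ ^ 2 ∂μ)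
          (𝓝 w₀) (𝓝 0) := by
        simpa using ENNReal.Tendsto.const_mul (Z1.tendsto_val α w₀) (Or.inr hc)
      refine tendsto_of_tendsto_of_tendsto_of_le_of_le tendsto_const_nhds hlim
        (fun _ => zero_le) fun w => ?_
      set g : X → ℝ≥0∞ := fun x => ‖w.val α x - w₀.val α x‖ₑ ^ 2 with hg
      have hgm : Measurable g :=
        ((w.val α).measurable.sub (w₀.val α).measurable).enorm.pow_const 2
      calc ∫⁻ y in A (some (k, l)),
            ‖(s.extend hℋ w).val φ y - (s.extend hℋ w₀).val φ y‖ₑ ^ 2 ∂ν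
          = ∫⁻ y in A (some (k, l)), g (Θ.invFun ((s.τ k).1.invFun y)) ∂ν := by
            refine setLIntegral_congr_fun_ae ?_ ?_
            · exact φ.1.measurableSet_target.inter ((s.τ k).1.measurableSet_target.inter
                ((hm1 k).inter (φ.1.measurable_invFun (hm1 l))))
            · filter_upwards [s.extend_val hℋ w φ, s.extend_val hℋ w₀ φ] with y h1 h2 hy
              obtain ⟨hy1, -, hk, hl⟩ := hy
              have hk' : s.index y = k := hk
              have hl' : s.index (φ.1.invFun y) = l := hl
              rw [h1 hy1, h2 hy1, hg]
              simp only [extFun, base, hk', hl', hα]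
        _ ≤ ∫⁻ y in (s.τ k).1.target, g (Θ.invFun ((s.τ k).1.invFun y)) ∂ν :=
            lintegral_mono_set fun y hy => hy.2.1
        _ = ∫⁻ z in (s.τ k).1.source, g (Θ.invFun z) ∂ν :=
            (s.τ k).1.lintegral_invFun (hgm.comp Θ.measurable_invFun)
        _ ≤ ∫⁻ z in Θ.target, g (Θ.invFun z) ∂ν := lintegral_mono_set (s.source_subset k)
        _ = c * ∫⁻ x, g x ∂μ := hint g hgm

/-- A cocycle of `𝒦` is a coboundary as soon as its restriction is: if `u` trivializes the
restriction, then `y ↦ conj (w_{τ_k}(y)) u(base y)`, with `k` the index of `y`, trivializes `w`. -/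
theorem mem_B1_of_pullback (s : Sweep 𝒦 Θ) [MeasurableEq Y] (w : Z1 𝒦)
    (hw : w.pullback Θ ℋ (fun φ hφ => (hℋ φ).1 hφ) ∈ B1 ℋ) : w ∈ B1 𝒦 := by
  obtain ⟨u, hum, hu1, hu⟩ := mem_B1_iff.1 hw
  refine mem_B1_iff.2 ⟨fun y => conj (w.val (s.τ (s.index y)) y) * u (s.base y), ?_, ?_, ?_⟩
  · have h : Measurable fun q : ℕ × Y => w.val (s.τ q.1) q.2 :=
      measurable_from_prod_countable_right fun k => (w.val (s.τ k)).measurable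
    exact (Complex.continuous_conj.measurable.comp
      (h.comp (s.measurable_index.prodMk measurable_id))).mul (hum.comp s.measurable_base)
  · filter_upwards [ae_all_iff.2 fun k => w.ae_norm_eq_one (s.τ k), s.mem_target, s.ae_base hu1]
      with y h1 h2 h3
    rw [norm_mul, Complex.norm_conj, h1 _ h2, h3, one_mul]
  · intro φ
    -- The germs at `y` of `φ τ_l` and of `τ_k` times the piece of `φ` coincide.
    set P : ℕ → ℕ → 𝒦.carrier := fun k l =>
      ⟨Θ.push (s.piece hℋ k l φ).1, (hℋ _).1 (s.piece hℋ k l φ).2⟩ with hP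
    have hpiece : ∀ᵐ y ∂ν, ∀ k l, s.base y ∈ (s.piece hℋ k l φ).1.target →
        w.val (P k l) (Θ (s.base y)) = conj (u (s.base y)) *
          u ((s.piece hℋ k l φ).1.invFun (s.base y)) :=
      ae_all_iff.2 fun k => ae_all_iff.2 fun l => by
        filter_upwards [s.ae_base (hu (s.piece hℋ k l φ)),
          s.ae_base (Z1.pullback_val Θ ℋ (fun φ hφ => (hℋ φ).1 hφ) w (s.piece hℋ k l φ))]
          with y h1 h2 hy
        rw [← h1 hy, h2]
    have hpush : ∀ᵐ y ∂ν, ∀ k l, s.base y ∈ (s.piece hℋ k l φ).1.target →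
        Θ (s.base y) ∈ (P k l).1.target :=
      ae_all_iff.2 fun k => ae_all_iff.2 fun l => by
        filter_upwards [s.ae_base (Θ.mem_push_target_ae (s.piece hℋ k l φ).1)] with y h1 hy
        exact h1.2 hy
    filter_upwards [s.mem_target, φ.1.ae_comp_inv s.mem_target, hpiece, hpush,
      ae_all_iff.2 fun l => w.ae_comp φ (s.τ l),
      ae_all_iff.2 fun k => ae_all_iff.2 fun l => w.ae_comp (s.τ k) (P k l),
      ae_all_iff.2 fun k => ae_all_iff.2 fun l =>
        w.ae_germ (FullGroupoid.mulElt φ (s.τ l)) (FullGroupoid.mulElt (s.τ k) (P k l)),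
      s.ae_base Θ.ae_source, φ.1.ae_comp_inv (ae_all_iff.2 fun l => w.ae_conj_mul_self (s.τ l)),
      ae_all_iff.2 fun k => w.ae_conj_mul_self (s.τ k)]
      with y h1 h2 h3 h4 h5 h6 h7 h8 h9 h10 hy
    have hl := h2 hy
    obtain ⟨g1, g2⟩ := s.piece_germ hℋ hy h1 hl
    set k := s.index y with hk
    set l := s.index (φ.1.invFun y) with hl'
    have a1 : (s.τ k).1.invFun y ∈ Θ.target := s.source_subset _ ((s.τ k).1.map_target' h1)
    have a2 : Θ (s.base y) = (s.τ k).1.invFun y := Θ.right_inv' a1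
    have a4 : (s.τ l).1.invFun (φ.1.invFun y) ∈ Θ.target :=
      s.source_subset _ ((s.τ l).1.map_target' hl)
    have a5 : Θ (s.base (φ.1.invFun y)) = (s.τ l).1.invFun (φ.1.invFun y) := Θ.right_inv' a4
    have b1 := h3 k l g1
    have b2 := h4 k l g1
    have b3 := h7 k l ((LocalIso.mem_comp_target φ.1 (s.τ l).1 y).2 ⟨hy, hl⟩)
      ((LocalIso.mem_comp_target (s.τ k).1 (P k l).1 y).2 ⟨h1, by rwa [← a2]⟩) (by
        change (s.τ l).1.invFun (φ.1.invFun y) = (P k l).1.invFun ((s.τ k).1.invFun y)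
        rw [← a2]
        change _ = Θ ((s.piece hℋ k l φ).1.invFun (Θ.invFun (Θ (s.base y))))
        rw [Θ.left_inv' h8, g2, a5])
    rw [h5 l hy, h6 k l h1, ← a2, b1, g2] at b3
    have c1 := h9 hy l hl
    have c2 := h10 k h1
    have c3 : conj (u (s.base y)) * conj (conj (w.val (s.τ k) y)) =
        w.val (s.τ k) y * conj (u (s.base y)) := by rw [Complex.conj_conj, mul_comm]
    calc w.val φ y
        = (w.val φ y * w.val (s.τ l) (φ.1.invFun y)) * conj (w.val (s.τ l) (φ.1.invFun y)) := by
          rw [mul_assoc, mul_comm (w.val (s.τ l) (φ.1.invFun y)), c1, mul_one]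
      _ = conj (conj (w.val (s.τ k) y) * u (s.base y)) *
          (conj (w.val (s.τ l) (φ.1.invFun y)) * u (s.base (φ.1.invFun y))) := by
          rw [b3, map_mul, Complex.conj_conj]; ring

theorem pullback_mem_B1 (w : Z1 𝒦) (hw : w ∈ B1 𝒦) :
    w.pullback Θ ℋ (fun φ hφ => (hℋ φ).1 hφ) ∈ B1 ℋ := by
  obtain ⟨u, hum, hu1, hu⟩ := mem_B1_iff.1 hw
  refine mem_B1_iff.2 ⟨fun x => u (Θ x), hum.comp Θ.measurable_toFun, Θ.ae_comp hu1, fun φ => ?_⟩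
  filter_upwards [Z1.pullback_val Θ ℋ (fun φ hφ => (hℋ φ).1 hφ) w φ,
    Θ.ae_comp (hu ⟨Θ.push φ.1, (hℋ _).1 φ.2⟩), Θ.mem_push_target_ae φ.1, Θ.ae_source]
    with x h1 h2 h3 h4 hx
  rw [h1, h2 (h3.2 hx)]
  change _ * u (Θ (φ.1.invFun (Θ.invFun (Θ x)))) = _
  rw [Θ.left_inv' h4]

/-- Restriction to a subset which sweeps out the space induces an isomorphism on `H¹`. -/
theorem exists_H1_equiv (s : Sweep 𝒦 Θ) [MeasurableEq X] [MeasurableEq Y] [IsFiniteMeasure μ]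
    [IsFiniteMeasure ν] : ∃ Φ : H1 𝒦 ≃ₜ* H1 ℋ, ∀ w : Z1 𝒦, Φ (QuotientGroup.mk w) =
      QuotientGroup.mk (w.pullback Θ ℋ (fun φ hφ => (hℋ φ).1 hφ)) :=
  exists_quotient_equiv (B1 𝒦) (B1 ℋ) (Z1.pullbackHom Θ ℋ fun φ hφ => (hℋ φ).1 hφ)
    (Z1.continuous_pullback Θ ℋ fun φ hφ => (hℋ φ).1 hφ) (s.extend hℋ) (s.continuous_extend hℋ)
    (s.pullback_extend hℋ)
    fun w => ⟨pullback_mem_B1 hℋ w, s.mem_B1_of_pullback hℋ w⟩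

end Sweep

/-- An isomorphism of the underlying spaces which carries `ℋ` onto `𝒦` induces an isomorphism of
the groups of cocycles. -/
theorem exists_Z1_equiv [MeasurableEq X] [IsFiniteMeasure μ] [IsFiniteMeasure ν]
    {𝒦 : FullGroupoid ν} {ℋ : FullGroupoid μ} (Θ : Embed μ ν) (hΘ : ν Θ.targetᶜ = 0)
    (hℋ : ∀ φ, φ ∈ ℋ.carrier ↔ Θ.push φ ∈ 𝒦.carrier) : Nonempty (Z1 𝒦 ≃ₜ* Z1 ℋ) := by
  set s := Sweep.ofConull 𝒦 Θ hΘ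
  set f := Z1.pullbackHom Θ ℋ fun φ hφ => (hℋ φ).1 hφ
  have hfs : ∀ w, f (s.extend hℋ w) = w := s.pullback_extend hℋ
  have hinj : Function.Injective f := by
    intro w w' h
    refine Z1.eq_of_ae fun φ => ?_
    set α : ℋ.carrier := ⟨Θ.corner Θ (.refl Θ) φ.1, (hℋ _).2 (Embed.push_corner_mem φ.2)⟩
    have hα : φ.1.AEEq (Θ.push α.1) := by
      refine LocalIso.AEEq.of_inv ?_ ?_
      · filter_upwards [ae_iff.2 hΘ, φ.1.ae_comp_inv (ae_iff.2 hΘ)] with y h1 h2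
        rw [Embed.mem_push_target, Embed.mem_corner_target, Embed.corner_invFun,
          Θ.right_inv' h1]
        exact ⟨fun h => ⟨h1, ⟨Θ.map_target' h1, h, h2 h⟩, Θ.map_target' (h2 h)⟩,
          fun h => h.2.1.2.1⟩
      · filter_upwards [ae_iff.2 hΘ, φ.1.ae_comp_inv (ae_iff.2 hΘ)] with y h1 h2 hy
        rw [Embed.push_invFun, Embed.corner_invFun, Θ.right_inv' h1, Θ.right_inv' (h2 hy)]
    have h1 : ∀ v : Z1 𝒦, ∀ᵐ y ∂ν, (f v).val α (Θ.invFun y) = v.val φ y := by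
      intro v
      filter_upwards [Θ.ae_comp_inv (Z1.pullback_val Θ ℋ (fun φ hφ => (hℋ φ).1 hφ) v α),
        ae_iff.2 hΘ] with y h1 h2
      rw [v.congr φ ⟨Θ.push α.1, (hℋ _).1 α.2⟩ hα]
      refine (h1 h2).trans ?_
      rw [Θ.right_inv' h2]
    filter_upwards [h1 w, h1 w'] with y h2 h3 _
    rw [← h2, ← h3, h]
  exact ⟨{ MulEquiv.ofBijective f ⟨hinj, fun w => ⟨_, hfs w⟩⟩ with
    continuous_toFun := Z1.continuous_pullback Θ ℋ fun φ hφ => (hℋ φ).1 hφ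
    continuous_invFun := (s.continuous_extend hℋ).congr fun w =>
      ((MulEquiv.ofBijective f ⟨hinj, fun w => ⟨_, hfs w⟩⟩).symm_apply_eq.2 (hfs w).symm).symm }⟩

end Sweep

/-! ### Exhaustion of an ergodic space by the translates of a non-null set -/

section Exhaustion

variable {X Y : Type*} [MeasurableSpace X] [MeasurableSpace Y] {μ : Measure X} {ν : Measure Y}

/-- Among all countable unions of members of a family of measurable sets, there is one which
contains every member of the family up to a null set. -/
theorem exists_countable_union_ae_max [IsFiniteMeasure ν] {ι : Type*} [Nonempty ι]
    (R : ι → Set Y) (hR : ∀ i, MeasurableSet (R i)) :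
    ∃ f : ℕ → ι, ∀ i, ν (R i \ ⋃ k, R (f k)) = 0 := by
  set V : (ℕ → ι) → ℝ≥0∞ := fun f => ν (⋃ k, R (f k)) with hV
  obtain ⟨v, -, hv, hvm⟩ := exists_seq_tendsto_sSup (S := range V) (range_nonempty V)
    (OrderTop.bddAbove _)
  choose F hF using hvm
  refine ⟨fun k => F k.unpair.1 k.unpair.2, fun i => ?_⟩
  set g : ℕ → ι := fun k => F k.unpair.1 k.unpair.2 with hg
  have hge : sSup (range V) ≤ V g := by
    refine le_of_tendsto' hv fun n => ?_
    rw [← hF n]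
    refine measure_mono (iUnion_subset fun k => ?_)
    refine subset_iUnion_of_subset (Nat.pair n k) ?_
    rw [hg]
    simp
  set g' : ℕ → ι := fun k => k.casesOn i g with hg'
  have h1 : ⋃ k, R (g' k) = R i ∪ ⋃ k, R (g k) := by
    ext y
    simp only [mem_iUnion, mem_union]
    constructor
    · rintro ⟨_ | k, hk⟩
      · exact Or.inl hk
      · exact Or.inr ⟨k, hk⟩
    · rintro (h | ⟨k, hk⟩)
      · exact ⟨0, h⟩
      · exact ⟨k + 1, hk⟩
  have h2 : V g' = ν (⋃ k, R (g k)) + ν (R i \ ⋃ k, R (g k)) := by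
    rw [hV]
    simp only
    rw [h1, union_comm, ← union_sdiff_self,
      measure_union disjoint_sdiff_right ((hR i).diff (MeasurableSet.iUnion fun k => hR _))]
  have h3 : V g' ≤ V g := (le_sSup (mem_range_self g')).trans hge
  rw [h2] at h3
  have h4 : ν (⋃ k, R (g k)) + ν (R i \ ⋃ k, R (g k)) ≤ ν (⋃ k, R (g k)) + 0 := by
    rw [add_zero]; exact h3
  exact nonpos_iff_eq_zero.1 ((ENNReal.add_le_add_iff_left (measure_ne_top _ _)).1 h4)

/-- A measurable choice of a member of a countable family of sets which contains a given point,
with preference for the first one. -/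
theorem exists_measurable_index (A : ℕ → Set Y) (hA : ∀ k, MeasurableSet (A k)) :
    ∃ K : Y → ℕ, Measurable K ∧ (∀ y, (∃ k, y ∈ A k) → y ∈ A (K y)) ∧ ∀ y ∈ A 0, K y = 0 := by
  classical
  have hex : ∀ y, ∃ k, y ∈ A k ∨ ∀ j, y ∉ A j := by
    intro y
    by_cases h : ∃ k, y ∈ A k
    · exact ⟨h.choose, Or.inl h.choose_spec⟩
    · exact ⟨0, Or.inr (not_exists.1 h)⟩
  refine ⟨fun y => Nat.find (hex y), measurable_find hex fun k => ?_, ?_, ?_⟩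
  · have h1 : {y | y ∈ A k ∨ ∀ j, y ∉ A j} = A k ∪ ⋂ j, (A j)ᶜ := by
      ext y
      simp
    rw [h1]
    exact (hA k).union (MeasurableSet.iInter fun j => (hA j).compl)
  · rintro y ⟨k, hk⟩
    exact (Nat.find_spec (hex y)).resolve_right fun h => h k hk
  · exact fun y hy => (Nat.find_eq_zero _).2 (Or.inl hy)

/-- An ergodic full groupoid is swept out by any non-null set. -/
theorem FullGroupoid.Ergodic.nonempty_sweep [IsFiniteMeasure ν] {𝒦 : FullGroupoid ν}
    (h𝒦 : 𝒦.Ergodic) (Θ : Embed μ ν) (h0 : ν Θ.target ≠ 0) : Nonempty (Sweep 𝒦 Θ) := by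
  set S := Θ.target with hS
  have hSm : MeasurableSet S := Θ.measurableSet_target
  set e : 𝒦.carrier := ⟨LocalIso.idOn ν S hSm, 𝒦.id_mem _ _⟩ with he
  have : Nonempty 𝒦.carrier := ⟨e⟩
  set R : 𝒦.carrier → Set Y := fun φ => φ.1.target ∩ φ.1.invFun ⁻¹' S with hRd
  obtain ⟨f, hf⟩ := exists_countable_union_ae_max (ν := ν) R fun φ =>
    φ.1.measurableSet_target.inter (φ.1.measurable_invFun hSm)
  set U : Set Y := ⋃ k, R (f k) with hU
  have hUm : MeasurableSet U := MeasurableSet.iUnion fun k =>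
    (f k).1.measurableSet_target.inter ((f k).1.measurable_invFun hSm)
  have hae : ∀ φ : 𝒦.carrier, ∀ᵐ y ∂ν, y ∈ R φ → y ∈ U := by
    intro φ
    rw [ae_iff]
    refine measure_mono_null ?_ (hf φ)
    intro y hy
    have hy' : y ∈ R φ ∧ y ∉ U := by simpa using hy
    exact hy'
  have hinv : ∀ φ ∈ 𝒦.carrier, ∀ᵐ x ∂ν, x ∈ φ.source → (x ∈ U ↔ φ x ∈ U) := by
    intro φ hφ
    filter_upwards [ae_all_iff.2 fun k => φ.ae_comp (hae (mulElt ⟨φ, hφ⟩ (f k))),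
      ae_all_iff.2 fun k => hae (mulElt ⟨φ.inv, 𝒦.inv_mem _ hφ⟩ (f k))] with x h1 h2 hx
    constructor
    · intro hxU
      obtain ⟨k, hk1, hk2⟩ := mem_iUnion.1 hxU
      have hinv : φ.invFun (φ x) = x := φ.left_inv' hx
      refine h1 k hx ⟨(LocalIso.mem_comp_target φ (f k).1 _).2 ⟨φ.map_source' hx, ?_⟩, ?_⟩
      · rw [hinv]; exact hk1
      · change (f k).1.invFun (φ.invFun (φ x)) ∈ S
        rw [hinv]; exact hk2
    · intro hxU
      obtain ⟨k, hk1, hk2⟩ := mem_iUnion.1 hxU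
      exact h2 k ⟨(LocalIso.mem_comp_target φ.inv (f k).1 _).2 ⟨hx, hk1⟩, hk2⟩
  have hUc : ν Uᶜ = 0 := by
    refine (h𝒦 U hUm hinv).resolve_left fun hU0 => h0 ?_
    refine measure_mono_null (t := (S \ U) ∪ U) (fun y hy => ?_) (measure_union_null ?_ hU0)
    · by_cases h : y ∈ U
      · exact Or.inr h
      · exact Or.inl ⟨hy, h⟩
    · have h1 : R e = S := by
        ext y
        exact ⟨fun h => h.1, fun h => ⟨h, h⟩⟩
      rw [← h1]
      exact hf e
  -- The identity of the range comes first, so that it is chosen wherever it is available.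
  set τ : ℕ → 𝒦.carrier := fun k => k.casesOn e fun k => mulElt (f k) e with hτ
  have hτ1 : ∀ k y, y ∈ (τ (k + 1)).1.target ↔ y ∈ R (f k) := fun k y =>
    LocalIso.mem_comp_target (f k).1 e.1 y
  obtain ⟨K, hKm, hK, hK0⟩ := exists_measurable_index (fun k => (τ k).1.target)
    fun k => (τ k).1.measurableSet_target
  refine ⟨{
    τ := τ
    index := K
    measurable_index := hKm
    mem_target := ?_
    source_subset := ?_
    eq_self := ?_ }⟩
  · filter_upwards [(ae_iff.2 hUc : ∀ᵐ y ∂ν, y ∈ U)] with y hy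
    obtain ⟨k, hk⟩ := mem_iUnion.1 hy
    exact hK y ⟨k + 1, (hτ1 k y).2 hk⟩
  · rintro (_ | k)
    · exact Subset.rfl
    · exact fun x hx => hx.1
  · refine Eventually.of_forall fun y hy => ?_
    rw [hK0 y hy]
    rfl

end Exhaustion

/-! ### Amplifications -/

section Matrix

variable {X Y : Type*} [MeasurableSpace X] [MeasurableSpace Y] {μ : Measure X} {ν : Measure Y}

/-- A local isomorphism belongs to a full groupoid if almost every point has a germ in common with
one of countably many elements of the groupoid. -/
theorem FullGroupoid.mem_of_cover [MeasurableEq X] (𝒢 : FullGroupoid μ) {κ : Type*} [Countable κ]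
    [Nonempty κ] {φ : LocalIso μ} (ψ : κ → LocalIso μ) (hψ : ∀ k, ψ k ∈ 𝒢.carrier)
    (h : ∀ᵐ x ∂μ, x ∈ φ.source → ∃ k, x ∈ (ψ k).source ∧ ψ k x = φ x) : φ ∈ 𝒢.carrier := by
  obtain ⟨e, he⟩ := exists_surjective_nat κ
  set A : ℕ → Set X := fun m =>
    (φ.source ∩ (ψ (e m)).source) ∩ {x | ψ (e m) x = φ x} with hA
  have hAm : ∀ m, MeasurableSet (A m) := fun m =>
    (φ.measurableSet_source.inter (ψ (e m)).measurableSet_source).inter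
      (measurableSet_eq_fun (ψ (e m)).measurable_toFun φ.measurable_toFun)
  have hUm : MeasurableSet (⋃ m, A m) := MeasurableSet.iUnion hAm
  have hdm : ∀ m, MeasurableSet (disjointed A m) := fun m => MeasurableSet.disjointed hAm m
  -- The part of the domain which the cover misses is null, and may be cut off.
  refine 𝒢.ae_mem (φ.restr _ hUm) φ ⟨?_, Eventually.of_forall fun _ _ => rfl⟩
    (𝒢.glue _ (disjointed A) hdm (disjoint_disjointed A) ?_ fun m => ?_)
  · filter_upwards [h] with x hx
    refine propext ⟨fun h => h.2, fun hs => ⟨?_, hs⟩⟩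
    obtain ⟨k, hk1, hk2⟩ := hx hs
    obtain ⟨m, rfl⟩ := he k
    exact mem_iUnion.2 ⟨m, ⟨hs, hk1⟩, hk2⟩
  · rw [iUnion_disjointed]
    ext x
    refine ⟨fun hx => ⟨hx, ?_⟩, fun hx => hx.1⟩
    obtain ⟨m, hm⟩ := mem_iUnion.1 hx
    exact hm.1.1
  · refine 𝒢.mem_of_restr (hψ (e m)) (Eventually.of_forall fun x hx => ?_)
    have hxA : x ∈ A m := disjointed_subset A m hx.1
    exact ⟨hxA.1.2, hxA.2⟩

/-- Restrictions of a cocycle along two embeddings which differ by an element of the groupoid are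
cohomologous. -/
theorem Z1.pullback_inv_mul_mem_B1 [MeasurableEq Y] {𝒦 : FullGroupoid ν} {ℋ : FullGroupoid μ}
    (Θ Θ' : Embed μ ν) (h : ∀ φ ∈ ℋ.carrier, Θ.push φ ∈ 𝒦.carrier)
    (h' : ∀ φ ∈ ℋ.carrier, Θ'.push φ ∈ 𝒦.carrier) (τ : 𝒦.carrier)
    (hτ : ∀ᵐ x ∂μ, Θ x ∈ τ.1.source ∧ τ.1 (Θ x) = Θ' x) (w : Z1 𝒦) :
    (w.pullback Θ' ℋ h')⁻¹ * w.pullback Θ ℋ h ∈ B1 ℋ := by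
  have hmem : ∀ᵐ x ∂μ, Θ' x ∈ τ.1.target := by
    filter_upwards [hτ] with x hx
    rw [← hx.2]
    exact τ.1.map_source' hx.1
  refine mem_B1_iff.2 ⟨fun x => w.val τ (Θ' x), (w.val τ).measurable.comp Θ'.measurable_toFun, ?_,
    fun φ => ?_⟩
  · filter_upwards [hmem, Θ'.ae_comp (w.ae_norm_eq_one τ)] with x h1 h2
    exact h2 h1
  set α : 𝒦.carrier := ⟨Θ.push φ.1, h _ φ.2⟩ with hα
  set β : 𝒦.carrier := ⟨Θ'.push φ.1, h' _ φ.2⟩ with hβ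
  have hinv : ∀ᵐ x ∂μ, τ.1.invFun (Θ' x) = Θ x := by
    filter_upwards [hτ] with x hx
    rw [← hx.2]
    exact τ.1.left_inv' hx.1
  set a := w.pullback Θ' ℋ h' with ha
  set b := w.pullback Θ ℋ h with hb
  filter_upwards [AEEqFun.coeFn_mul (star (a.val φ)) (b.val φ), AEEqFun.coeFn_star (a.val φ),
    Z1.pullback_val Θ ℋ h w φ, Z1.pullback_val Θ' ℋ h' w φ,
    Θ'.ae_comp (w.ae_germ (FullGroupoid.mulElt β τ) (FullGroupoid.mulElt τ α)),
    Θ'.ae_comp (w.ae_comp β τ), Θ'.ae_comp (w.ae_comp τ α), Θ.mem_push_target_ae φ.1,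
    Θ'.mem_push_target_ae φ.1, hmem, φ.1.ae_comp_inv hmem, hinv, φ.1.ae_comp_inv hinv,
    Θ.ae_source, Θ'.ae_source, a.ae_conj_mul_self φ, Θ'.ae_comp (w.ae_conj_mul_self τ)]
    with x h1 h2 h3 h4 h5 h6 h7 h8 h9 h10 h11 h12 h13 h14 h15 h16 h17 hx
  have e1 : β.1.invFun (Θ' x) = Θ' (φ.1.invFun x) := by
    change Θ' (φ.1.invFun (Θ'.invFun (Θ' x))) = _
    rw [Θ'.left_inv' h15]
  have e2 : α.1.invFun (Θ x) = Θ (φ.1.invFun x) := by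
    change Θ (φ.1.invFun (Θ.invFun (Θ x))) = _
    rw [Θ.left_inv' h14]
  have h18 := h5 ((LocalIso.mem_comp_target β.1 τ.1 _).2 ⟨h9.2 hx, by rw [e1]; exact h11 hx⟩)
    ((LocalIso.mem_comp_target τ.1 α.1 _).2 ⟨h10, by rw [h12]; exact h8.2 hx⟩) (by
      change τ.1.invFun (β.1.invFun (Θ' x)) = α.1.invFun (τ.1.invFun (Θ' x))
      rw [e1, h12, e2, h13 hx])
  rw [h6 (h9.2 hx), h7 h10, e1, h12] at h18
  have h19 : (a⁻¹ * b).val φ x = conj (a.val φ x) * b.val φ x := by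
    rw [Z1.mul_val, Z1.inv_val, h1, Pi.mul_apply, h2]
    rfl
  have h20 : a.val φ x = w.val β (Θ' x) := h4
  have h21 : b.val φ x = w.val α (Θ x) := h3
  have h22 := h16 hx
  rw [h20] at h22
  rw [h19, h20, h21]
  calc conj (w.val β (Θ' x)) * w.val α (Θ x)
      = conj (w.val β (Θ' x)) * ((conj (w.val τ (Θ' x)) * w.val τ (Θ' x)) * w.val α (Θ x)) := by
        rw [h17 h10, one_mul]
    _ = conj (w.val τ (Θ' x)) * (conj (w.val β (Θ' x)) * (w.val τ (Θ' x) * w.val α (Θ x))) := by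
        ring
    _ = conj (w.val τ (Θ' x)) * ((conj (w.val β (Θ' x)) * w.val β (Θ' x)) *
          w.val τ (Θ' (φ.1.invFun x))) := by rw [← h18]; ring
    _ = conj (w.val τ (Θ' x)) * w.val τ (Θ' (φ.1.invFun x)) := by rw [h22, one_mul]

theorem unif_image {n : ℕ} (σ : Equiv.Perm (Fin n)) (E : Set (Fin n)) :
    unif n (σ '' E) = unif n E := by
  simp only [unif, ProbabilityTheory.uniformOn, ProbabilityTheory.cond_apply MeasurableSet.univ,
    univ_inter]
  rw [Measure.count_injective_image σ.injective]

theorem unif_singleton_ne_zero {n : ℕ} (i : Fin n) : unif n {i} ≠ 0 := by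
  have : Nonempty (Fin n) := ⟨i⟩
  simp [unif, ProbabilityTheory.uniformOn, ProbabilityTheory.cond_apply]

/-- A permutation of `n` points, as a local isomorphism. -/
def permIso {n : ℕ} (σ : Equiv.Perm (Fin n)) : LocalIso (unif n) where
  toPartialEquiv := σ.toPartialEquiv
  measurable_toFun := measurable_of_finite _
  measurable_invFun := measurable_of_finite _
  measurableSet_source := MeasurableSet.univ
  measurableSet_target := MeasurableSet.univ
  measure_image := fun E _ _ => unif_image σ E

theorem Embed.slice_sameScale (μ : Measure X) [SFinite μ] {n : ℕ} (i j : Fin n) :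
    (Embed.slice μ n i).SameScale (Embed.slice μ n j) := by
  have : Nonempty (Fin n) := ⟨i⟩
  have himage : ∀ (k : Fin n) (E : Set X),
      (μ.prod (unif n)) ((fun x : X => (x, k)) '' E) = unif n {k} * μ E := by
    intro k E
    have : (fun x : X => (x, k)) '' E = E ×ˢ {k} := by rw [prod_singleton]
    rw [this, Measure.prod_prod, mul_comm]
  have hij : unif n {i} = unif n {j} := by
    rw [← unif_image (Equiv.swap i j) {i}, image_singleton, Equiv.swap_apply_left]
  refine ⟨unif n {i}, unif_singleton_ne_zero i, measure_ne_top _ _, fun E _ _ => himage i E,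
    fun E _ _ => ?_⟩
  rw [hij]
  exact himage j E

/-- A property holds almost everywhere on `X × {1, …, n}` if it does on every slice. -/
theorem ae_prod_of_slice [SFinite μ] {n : ℕ} {p : X × Fin n → Prop}
    (h : ∀ i, ∀ᵐ x ∂μ, p (x, i)) : ∀ᵐ y ∂μ.prod (unif n), p y := by
  filter_upwards [ae_all_iff.2 fun i => (Embed.slice μ n i).ae_comp_inv (h i)] with y hy
  exact hy y.2 ⟨trivial, rfl⟩

namespace FullGroupoid

variable [SFinite μ] (𝒢 : FullGroupoid μ) {n : ℕ}

/-- The full groupoid of those local isomorphisms of `X × {1, …, n}` all of whose corners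
`X × {i} → X × {j}` belong to `𝒢`. -/
def cornerGroupoid [MeasurableEq X] (n : ℕ) : FullGroupoid (μ.prod (unif n)) where
  carrier := {ψ | ∀ i j, (Embed.slice μ n i).corner (Embed.slice μ n j)
    (Embed.slice_sameScale μ i j) ψ ∈ 𝒢.carrier}
  ae_mem := by
    intro φ ψ h hφ i j
    refine 𝒢.mem_of_restr (hφ i j) ?_
    filter_upwards [(Embed.slice μ n i).ae_comp h.1.mem_iff, (Embed.slice μ n i).ae_comp h.2]
      with x h1 h2 hx
    obtain ⟨-, hx1, hx2⟩ := (Embed.mem_corner_source _ _ _).1 hx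
    have h3 := h1.2 hx1
    have h4 := h2 h3
    refine ⟨(Embed.mem_corner_source _ _ _).2 ⟨trivial, h3, by rwa [h4]⟩, ?_⟩
    rw [Embed.corner_apply, Embed.corner_apply, h4]
  comp_mem := by
    intro φ ψ hφ hψ i j
    have : Nonempty (Fin n) := ⟨i⟩
    refine 𝒢.mem_of_cover (fun k : Fin n =>
      ((Embed.slice μ n k).corner (Embed.slice μ n j) (Embed.slice_sameScale μ k j) φ).comp
        ((Embed.slice μ n i).corner (Embed.slice μ n k) (Embed.slice_sameScale μ i k) ψ))
      (fun k => 𝒢.comp_mem _ _ (hφ k j) (hψ i k)) (Eventually.of_forall fun x hx => ?_)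
    obtain ⟨-, ⟨hx1, hx2⟩, hx3⟩ := (Embed.mem_corner_source _ _ _).1 hx
    refine ⟨(ψ (x, i)).2, ⟨?_, ?_⟩, rfl⟩
    · exact ⟨trivial, hx1, trivial, rfl⟩
    · exact ⟨trivial, hx2, hx3⟩
  inv_mem := by
    intro φ hφ i j
    refine 𝒢.mem_of_restr (𝒢.inv_mem _ (hφ j i)) (Eventually.of_forall fun x hx => ?_)
    obtain ⟨-, hx1, hx2⟩ := (Embed.mem_corner_source _ _ _).1 hx
    exact ⟨(Embed.mem_corner_target (Embed.slice_sameScale μ j i) _ _).2 ⟨trivial, hx1, hx2⟩, rfl⟩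
  id_mem := by
    intro T hT i j
    refine 𝒢.mem_of_restr (𝒢.id_mem univ MeasurableSet.univ) (Eventually.of_forall fun x _ => ?_)
    exact ⟨trivial, rfl⟩
  glue := by
    intro φ R hR _ hu h i j
    refine 𝒢.mem_of_cover (fun k => (Embed.slice μ n i).corner (Embed.slice μ n j)
      (Embed.slice_sameScale μ i j) (φ.restr (R k) (hR k))) (fun k => h k i j)
      (Eventually.of_forall fun x hx => ?_)
    obtain ⟨-, hx1, hx2⟩ := (Embed.mem_corner_source _ _ _).1 hx
    have hx3 := hx1
    rw [← hu] at hx3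
    obtain ⟨k, hk⟩ := mem_iUnion.1 hx3
    exact ⟨k, ⟨trivial, ⟨hk, hx1⟩, hx2⟩, rfl⟩

theorem matrix_subset_cornerGroupoid [MeasurableEq X] :
    (𝒢.matrix n).carrier ⊆ (𝒢.cornerGroupoid n).carrier := by
  intro ψ hψ
  refine hψ _ ?_
  rintro _ ⟨φ, hφ, d, rfl⟩ i j
  refine 𝒢.mem_of_restr hφ (Eventually.of_forall fun x hx => ?_)
  obtain ⟨-, hx1, -⟩ := (Embed.mem_corner_source _ _ _).1 hx
  exact ⟨hx1.1, rfl⟩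

/-- The restriction of the amplified groupoid to a slice is the groupoid itself. -/
theorem mem_iff_slice_push_mem [MeasurableEq X] (i : Fin n) (φ : LocalIso μ) :
    φ ∈ 𝒢.carrier ↔ (Embed.slice μ n i).push φ ∈ (𝒢.matrix n).carrier := by
  refine ⟨𝒢.slice_mem n i φ, fun h => ?_⟩
  refine 𝒢.mem_of_restr (𝒢.matrix_subset_cornerGroupoid h i i)
    (Eventually.of_forall fun x hx => ⟨?_, rfl⟩)
  exact (Embed.mem_corner_source _ _ _).2
    ⟨trivial, ⟨⟨trivial, rfl⟩, hx, trivial⟩, ⟨trivial, rfl⟩⟩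

/-- The element of the amplification which permutes the slices. -/
def permElt (σ : Equiv.Perm (Fin n)) : (𝒢.matrix n).carrier :=
  ⟨(LocalIso.idOn μ univ MeasurableSet.univ).prod (permIso σ),
    subset_generate _ ⟨_, 𝒢.id_mem _ _, _, rfl⟩⟩

theorem Ergodic.matrix {𝒢 : FullGroupoid μ} (h𝒢 : 𝒢.Ergodic) : (𝒢.matrix n).Ergodic := by
  intro E hE hinv
  have hslice : ∀ i : Fin n, MeasurableSet {x : X | (x, i) ∈ E} := fun i =>
    measurable_prodMk_right hE
  have h1 : ∀ i : Fin n, μ {x : X | (x, i) ∈ E} = 0 ∨ μ {x : X | (x, i) ∈ E}ᶜ = 0 := by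
    intro i
    refine h𝒢 _ (hslice i) fun φ hφ => ?_
    filter_upwards [(Embed.slice μ n i).ae_comp (hinv _ (𝒢.slice_mem n i φ hφ))] with x hx hs
    exact hx ⟨⟨trivial, rfl⟩, hs, trivial⟩
  have h2 : ∀ i j : Fin n, ∀ᵐ x ∂μ, (x, i) ∈ E ↔ (x, j) ∈ E := by
    intro i j
    filter_upwards [(Embed.slice μ n i).ae_comp (hinv _ (𝒢.permElt (Equiv.swap i j)).2)] with x hx
    have h3 : (x, i) ∈ E ↔ (x, Equiv.swap i j i) ∈ E := hx ⟨trivial, trivial⟩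
    rwa [Equiv.swap_apply_left] at h3
  rcases isEmpty_or_nonempty (Fin n) with hn | ⟨⟨i⟩⟩
  · left
    have : E = ∅ := by
      ext y
      exact isEmptyElim y.2
    rw [this, measure_empty]
  · refine (h1 i).imp (fun h => ?_) fun h => ?_
    · have h3 : ∀ᵐ x ∂μ, (x, i) ∉ E := by
        rw [ae_iff]; simpa using h
      have h4 : ∀ᵐ y ∂μ.prod (unif n), y ∉ E := ae_prod_of_slice fun j => by
        filter_upwards [h3, h2 i j] with x h5 h6
        rwa [← h6]
      rw [ae_iff] at h4
      simpa using h4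
    · have h3 : ∀ᵐ x ∂μ, (x, i) ∈ E := h
      have h4 : ∀ᵐ y ∂μ.prod (unif n), y ∈ E := ae_prod_of_slice fun j => by
        filter_upwards [h3, h2 i j] with x h5 h6
        rwa [← h6]
      exact h4

/-- The slices of a cocycle of the amplification are cohomologous to each other. -/
theorem mk_slice_eq [MeasurableEq X] [MeasurableEq (X × Fin n)] (w : Z1 (𝒢.matrix n))
    (i j : Fin n) : (QuotientGroup.mk (w.slice i) : H1 𝒢) = QuotientGroup.mk (w.slice j) := by
  rw [QuotientGroup.eq]
  refine Z1.pullback_inv_mul_mem_B1 (Embed.slice μ n j) (Embed.slice μ n i) (𝒢.slice_mem n j)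
    (𝒢.slice_mem n i) (𝒢.permElt (Equiv.swap j i)) (Eventually.of_forall fun x => ?_) w
  refine ⟨⟨trivial, trivial⟩, ?_⟩
  change (x, Equiv.swap j i j) = (x, i)
  rw [Equiv.swap_apply_left]

end FullGroupoid

/-- Both `H¹(𝒢)`, through any slice, and the cohomology of the restriction to `S` are identified
with `H¹` of the whole amplification; all the slices give the same identification. -/
theorem existsUnique_H1_amplification [StandardBorelSpace X] [IsProbabilityMeasure μ]
    {𝒢 : FullGroupoid μ} (h𝒢 : 𝒢.Ergodic) {n : ℕ} {S : Set (X × Fin n)} (hS : MeasurableSet S)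
    (h0 : (μ.prod (unif n)) S ≠ 0) :
    ∃! Φ : H1 𝒢 ≃ₜ* H1 ((𝒢.matrix n).restrict S hS), ∀ (w : Z1 (𝒢.matrix n)) (i : Fin n),
      Φ (QuotientGroup.mk (w.slice i)) = QuotientGroup.mk (w.restrict S hS) := by
  have hn : Nonempty (Fin n) := by
    by_contra hn
    rw [not_nonempty_iff] at hn
    refine h0 ?_
    have : S = ∅ := by
      ext y
      exact isEmptyElim y.2
    rw [this, measure_empty]
  obtain ⟨i₀⟩ := hn
  have hne : (μ.prod (unif n)) (Embed.slice μ n i₀).target ≠ 0 := by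
    change (μ.prod (unif n)) (univ ×ˢ {i₀}) ≠ 0
    rw [Measure.prod_prod, measure_univ, one_mul]
    exact unif_singleton_ne_zero i₀
  obtain ⟨s⟩ := (h𝒢.matrix (n := n)).nonempty_sweep (Embed.slice μ n i₀) hne
  obtain ⟨s'⟩ := (h𝒢.matrix (n := n)).nonempty_sweep (Embed.ofSubset _ S hS) h0
  obtain ⟨Φ, hΦ⟩ := s.exists_H1_equiv (𝒢.mem_iff_slice_push_mem i₀)
  obtain ⟨Ψ, hΨ⟩ := s'.exists_H1_equiv (ℋ := (𝒢.matrix n).restrict S hS) fun _ => Iff.rfl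
  have hΦ' : ∀ w : Z1 (𝒢.matrix n), Φ (QuotientGroup.mk w) = QuotientGroup.mk (w.slice i₀) := hΦ
  refine ⟨Φ.symm.trans Ψ, fun w i => ?_, fun Φ' hΦ'' => ?_⟩
  · rw [𝒢.mk_slice_eq w i i₀, ← hΦ']
    change Ψ (Φ.symm (Φ _)) = _
    rw [ContinuousMulEquiv.symm_apply_apply]
    exact hΨ w
  · ext q
    obtain ⟨p, rfl⟩ := Φ.surjective q
    obtain ⟨w, rfl⟩ := QuotientGroup.mk_surjective p
    change _ = Ψ (Φ.symm (Φ _))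
    rw [ContinuousMulEquiv.symm_apply_apply, hΦ', hΦ'']
    exact (hΨ w).symm

end Matrix

/-! ### Cocycles of free actions -/

section Actions

variable {X : Type*} [MeasurableSpace X] {μ : Measure X} {G : Type*} [Group G] [MulAction G X]
  [SMulInvariantMeasure G X μ]

/-- Almost every germ of an element of the orbit groupoid is a germ of a group element. -/
theorem ae_exists_invFun_eq (φ : (orbitGroupoid G μ).carrier) :
    ∀ᵐ y ∂μ, y ∈ φ.1.target → ∃ g : G, φ.1.invFun y = g⁻¹ • y := by
  have h : ∀ᵐ y ∂μ, y ∈ φ.1.target → ∃ g : G, φ.1.invFun y = g • y :=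
    (orbitGroupoid G μ).inv_mem _ φ.2
  filter_upwards [h] with y h1 hy
  obtain ⟨g, hg⟩ := h1 hy
  exact ⟨g⁻¹, by rw [inv_inv, hg]⟩

variable [MeasurableConstSMul G X]

theorem ActZ1.continuous_iff [IsFiniteMeasure μ] {T : Type*} [TopologicalSpace T]
    (F : T → ActZ1 G μ) : Continuous F ↔ ∀ g t₀,
      Tendsto (fun t => ∫⁻ x, ‖toC ((F t).1 g) x - toC ((F t₀).1 g) x‖ₑ ^ 2 ∂μ) (𝓝 t₀)
        (𝓝 0) := by
  rw [continuous_induced_rng, continuous_pi_iff]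
  refine forall_congr' fun g => ?_
  rw [continuous_iff_continuousAt]
  exact forall_congr' fun t₀ => tendsto_toL2_iff _ (fun t => ae_norm_toC_le ((F t).1 g)) _
    (ae_norm_toC_le ((F t₀).1 g))

theorem coeFn_toC_sigma (g : G) (u : X →ₘ[μ] Circle) :
    ∀ᵐ x ∂μ, toC (sigma g u) x = toC u (g⁻¹ • x) := by
  have hmp := measurePreserving_smul g⁻¹ μ
  filter_upwards [coeFn_toC (sigma g u), AEEqFun.coeFn_compMeasurePreserving u hmp,
    hmp.quasiMeasurePreserving.ae (coeFn_toC u)] with x h1 h2 h3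
  rw [h1, h3]
  exact congrArg Circle.coeHom h2

theorem coeFn_toC_mul (u v : X →ₘ[μ] Circle) :
    ∀ᵐ x ∂μ, toC (u * v) x = toC u x * toC v x := by
  rw [toC_mul]
  exact AEEqFun.coeFn_mul _ _

theorem coeFn_toC_inv (u : X →ₘ[μ] Circle) : ∀ᵐ x ∂μ, toC u⁻¹ x = conj (toC u x) := by
  rw [toC_inv]
  exact AEEqFun.coeFn_star _

/-- The element of the orbit groupoid given by a group element. -/
def smulElt (μ : Measure X) [SMulInvariantMeasure G X μ] (g : G) : (orbitGroupoid G μ).carrier :=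
  ⟨LocalIso.ofSMul G μ g, ofSMul_mem G μ g⟩

theorem ae_smul {p : X → Prop} (h : ∀ᵐ x ∂μ, p x) (g : G) : ∀ᵐ x ∂μ, p (g • x) :=
  (measurePreserving_smul g μ).quasiMeasurePreserving.ae h

theorem exists_toC_eq_val (w : Z1 (orbitGroupoid G μ)) (g : G) :
    ∃ u : X →ₘ[μ] Circle, toC u = w.val (smulElt μ g) := by
  obtain ⟨u, hu⟩ := exists_toC_eq (w.val (smulElt μ g)).measurable
    ((w.ae_norm_eq_one (smulElt μ g)).mono fun x hx => hx trivial)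
  exact ⟨u, AEEqFun.ext hu⟩

/-- The restriction of a cocycle of the orbit groupoid to the group. -/
def toActZ1 (w : Z1 (orbitGroupoid G μ)) : ActZ1 G μ :=
  ⟨fun g => (exists_toC_eq_val w g).choose, by
    intro g h
    apply toC_injective
    apply AEEqFun.ext
    have hc : w.val (smulElt μ (g * h)) =
        w.val (FullGroupoid.mulElt (smulElt μ g) (smulElt μ h)) :=
      w.congr _ _ ⟨Eventually.of_forall fun x => propext ⟨fun _ => ⟨trivial, trivial⟩,
        fun _ => trivial⟩, Eventually.of_forall fun x _ => mul_smul g h x⟩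
    filter_upwards [coeFn_toC_mul (exists_toC_eq_val w g).choose
      (sigma g (exists_toC_eq_val w h).choose),
      coeFn_toC_sigma g (exists_toC_eq_val w h).choose,
      w.ae_comp (smulElt μ g) (smulElt μ h)] with x h1 h2 h3
    rw [h1, h2, (exists_toC_eq_val w g).choose_spec, (exists_toC_eq_val w h).choose_spec,
      (exists_toC_eq_val w (g * h)).choose_spec, hc]
    exact h3 trivial⟩

theorem toC_toActZ1 (w : Z1 (orbitGroupoid G μ)) (g : G) :
    toC ((toActZ1 w).1 g) = w.val (smulElt μ g) := (exists_toC_eq_val w g).choose_spec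

/-- The restriction of cocycles to the group, as a homomorphism. -/
def toActZ1Hom : Z1 (orbitGroupoid G μ) →* ActZ1 G μ :=
  MonoidHom.mk' toActZ1 fun a b => by
    apply Subtype.ext
    funext g
    apply toC_injective
    change _ = toC ((toActZ1 a).1 g * (toActZ1 b).1 g)
    rw [toC_mul, toC_toActZ1, toC_toActZ1, toC_toActZ1, Z1.mul_val]

theorem continuous_toActZ1 [IsFiniteMeasure μ] :
    Continuous (toActZ1 : Z1 (orbitGroupoid G μ) → ActZ1 G μ) := by
  rw [ActZ1.continuous_iff]
  intro g w₀
  simp_rw [toC_toActZ1]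
  exact Z1.tendsto_val _ w₀

theorem ae_val_eq_smulElt [Countable G] [MeasurableEq X] (w : Z1 (orbitGroupoid G μ))
    (φ : (orbitGroupoid G μ).carrier) : ∀ᵐ y ∂μ, y ∈ φ.1.target →
      ∀ g : G, φ.1.invFun y = g⁻¹ • y → w.val φ y = w.val (smulElt μ g) y := by
  filter_upwards [ae_all_iff.2 fun g => w.ae_germ φ (smulElt μ g)] with y h hy g hg
  exact h g hy trivial hg

variable [Countable G]

/-- An enumeration of a countable group. -/
def enum (G : Type*) [Group G] [Countable G] : ℕ → G := (exists_surjective_nat G).choose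

theorem enum_surjective (G : Type*) [Group G] [Countable G] : Function.Surjective (enum G) :=
  (exists_surjective_nat G).choose_spec

variable [MeasurableEq X]

theorem exists_germ_index (φ : (orbitGroupoid G μ).carrier) : ∃ K : X → ℕ, Measurable K ∧
    ∀ y, (∃ g : G, φ.1.invFun y = g⁻¹ • y) → φ.1.invFun y = (enum G (K y))⁻¹ • y := by
  obtain ⟨K, hKm, hK, -⟩ := exists_measurable_index
    (fun k => {y | φ.1.invFun y = (enum G k)⁻¹ • y}) fun k =>
      measurableSet_eq_fun φ.1.measurable_invFun (measurable_const_smul _)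
  refine ⟨K, hKm, ?_⟩
  rintro y ⟨g, hg⟩
  obtain ⟨k, rfl⟩ := enum_surjective G g
  exact hK y ⟨k, hg⟩

/-- A measurable choice of a group element, in the enumeration of the group, with the same germ at
`φ⁻¹ y` as `φ`. -/
def germIndex (φ : (orbitGroupoid G μ).carrier) : X → ℕ := (exists_germ_index φ).choose

theorem measurable_germIndex (φ : (orbitGroupoid G μ).carrier) : Measurable (germIndex φ) :=
  (exists_germ_index φ).choose_spec.1

theorem invFun_eq_germIndex (φ : (orbitGroupoid G μ).carrier) {y : X}
    (h : ∃ g : G, φ.1.invFun y = g⁻¹ • y) :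
    φ.1.invFun y = (enum G (germIndex φ y))⁻¹ • y :=
  (exists_germ_index φ).choose_spec.2 y h

/-- The pointwise values of the extension of a cocycle of the action to the orbit groupoid. -/
def actExtFun (c : ActZ1 G μ) (φ : (orbitGroupoid G μ).carrier) (y : X) : ℂ :=
  toC (c.1 (enum G (germIndex φ y))) y

theorem measurable_actExtFun (c : ActZ1 G μ) (φ : (orbitGroupoid G μ).carrier) :
    Measurable (actExtFun c φ) := by
  have h1 : Measurable fun q : ℕ × X => toC (c.1 (enum G q.1)) q.2 :=
    measurable_from_prod_countable_right fun k => (toC (c.1 (enum G k))).measurable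
  have h := h1.comp ((measurable_germIndex φ).prodMk measurable_id)
  simp only [Function.comp_def] at h
  exact h

/-- By freeness, the group element which has a given germ is unique. -/
theorem ae_actExtFun (hfree : IsFreeAction G μ) (c : ActZ1 G μ)
    (φ : (orbitGroupoid G μ).carrier) : ∀ᵐ y ∂μ, ∀ g : G, φ.1.invFun y = g⁻¹ • y →
      actExtFun c φ y = toC (c.1 g) y := by
  have hfree' : ∀ᵐ y ∂μ, ∀ g : G, g ≠ 1 → g • y ≠ y :=
    ae_all_iff.2 fun g => by
      by_cases hg : g = 1
      · exact Eventually.of_forall fun y h => absurd hg h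
      · exact (hfree g hg).mono fun y h _ => h
  filter_upwards [hfree'] with y h1 g hg
  have h2 := invFun_eq_germIndex φ ⟨g, hg⟩
  rw [hg] at h2
  have h3 : enum G (germIndex φ y) = g := by
    by_contra hne
    refine h1 (enum G (germIndex φ y) * g⁻¹) (fun h => hne (mul_inv_eq_one.1 h)) ?_
    rw [mul_smul, h2, smul_inv_smul]
  rw [actExtFun, h3]

/-- The extension of a cocycle of the action to the orbit groupoid. -/
def ofActZ1 (hfree : IsFreeAction G μ) (c : ActZ1 G μ) : Z1 (orbitGroupoid G μ) := by
  refine Z1.ofFun _ (actExtFun c) (measurable_actExtFun c) ?_ ?_ ?_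
  · intro φ ψ h
    filter_upwards [ae_actExtFun hfree c φ, ae_actExtFun hfree c ψ, h.invFun,
      ae_exists_invFun_eq φ] with y h1 h2 h3 h4 hy
    obtain ⟨g, hg⟩ := h4 hy
    rw [h1 g hg, h2 g (by rw [← h3 hy, hg])]
  · intro φ
    filter_upwards [ae_all_iff.2 fun k => ae_norm_toC (c.1 (enum G k))] with y h1 _
    exact h1 _
  · intro φ ψ
    have hc : ∀ᵐ y ∂μ, ∀ g h, toC (c.1 (g * h)) y = toC (c.1 g) y * toC (c.1 h) (g⁻¹ • y) :=
      ae_all_iff.2 fun g => ae_all_iff.2 fun h => by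
        rw [c.2 g h]
        filter_upwards [coeFn_toC_mul (c.1 g) (sigma g (c.1 h)), coeFn_toC_sigma g (c.1 h)]
          with y h1 h2
        rw [h1, h2]
    filter_upwards [ae_actExtFun hfree c φ, φ.1.ae_comp_inv (ae_actExtFun hfree c ψ),
      ae_actExtFun hfree c (FullGroupoid.mulElt φ ψ), ae_exists_invFun_eq φ,
      φ.1.ae_comp_inv (ae_exists_invFun_eq ψ), hc] with y h1 h2 h3 h4 h5 h6 hy hz
    obtain ⟨g, hg⟩ := h4 hy
    obtain ⟨h, hh⟩ := h5 hy hz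
    have e : (FullGroupoid.mulElt φ ψ).1.invFun y = (g * h)⁻¹ • y := by
      change ψ.1.invFun (φ.1.invFun y) = _
      rw [hh, hg, mul_inv_rev, mul_smul]
    rw [h1 g hg, h2 hy h hh, h3 _ e, h6, hg]

theorem ofActZ1_val (hfree : IsFreeAction G μ) (c : ActZ1 G μ)
    (φ : (orbitGroupoid G μ).carrier) : ∀ᵐ y ∂μ, y ∈ φ.1.target →
      (ofActZ1 hfree c).val φ y = actExtFun c φ y :=
  Z1.ofFun_val _ _ _ _ _ φ

theorem toActZ1_ofActZ1 (hfree : IsFreeAction G μ) (c : ActZ1 G μ) :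
    toActZ1 (ofActZ1 hfree c) = c := by
  apply Subtype.ext
  funext g
  apply toC_injective
  rw [toC_toActZ1]
  apply AEEqFun.ext
  filter_upwards [ofActZ1_val hfree c (smulElt μ g), ae_actExtFun hfree c (smulElt μ g)]
    with y h1 h2
  rw [h1 trivial, h2 g rfl]

theorem toActZ1_injective : Function.Injective (toActZ1 : Z1 (orbitGroupoid G μ) → ActZ1 G μ) := by
  intro w w' h
  refine Z1.eq_of_ae fun φ => ?_
  filter_upwards [ae_val_eq_smulElt w φ, ae_val_eq_smulElt w' φ, ae_exists_invFun_eq φ]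
    with y h1 h2 h3 hy
  obtain ⟨g, hg⟩ := h3 hy
  rw [h1 hy g hg, h2 hy g hg, ← toC_toActZ1, ← toC_toActZ1, h]

theorem continuous_ofActZ1 [IsFiniteMeasure μ] (hfree : IsFreeAction G μ) :
    Continuous (ofActZ1 hfree) := by
  rw [Z1.continuous_iff]
  intro φ c₀
  have hm : ∀ k, MeasurableSet {y | germIndex φ y = k} := fun k =>
    measurable_germIndex φ (measurableSet_singleton k)
  set A : Option ℕ → Set X := fun o => o.elim φ.1.targetᶜ fun k =>
    φ.1.target ∩ {y | germIndex φ y = k} with hA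
  have hAm : ∀ o, MeasurableSet (A o) := by
    rintro (_ | k)
    · exact φ.1.measurableSet_target.compl
    · exact φ.1.measurableSet_target.inter (hm k)
  refine tendsto_lintegral_of_cover _ (C := 4) (by norm_num)
    (fun c => ae_enorm_sub_sq_le ((ofActZ1 hfree c).ae_norm_le φ)
      ((ofActZ1 hfree c₀).ae_norm_le φ)) A hAm (Eventually.of_forall fun y => ?_) ?_
  · by_cases hy : y ∈ φ.1.target
    · exact ⟨some (germIndex φ y), hy, rfl⟩
    · exact ⟨none, hy⟩
  · rintro (_ | k)
    · have : ∀ c, ∫⁻ y in A none,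
          ‖(ofActZ1 hfree c).val φ y - (ofActZ1 hfree c₀).val φ y‖ₑ ^ 2 ∂μ = 0 := by
        intro c
        rw [← lintegral_zero (μ := μ.restrict (A none))]
        refine setLIntegral_congr_fun_ae (hAm _) ?_
        filter_upwards [(ofActZ1 hfree c).ae_eq_zero φ, (ofActZ1 hfree c₀).ae_eq_zero φ]
          with y h1 h2 hy
        rw [h1 hy, h2 hy]
        simp
      simp_rw [this]
      exact tendsto_const_nhds
    · have hlim := (ActZ1.continuous_iff (fun c : ActZ1 G μ => c)).1 continuous_id (enum G k) c₀
      refine tendsto_of_tendsto_of_tendsto_of_le_of_le tendsto_const_nhds hlim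
        (fun _ => zero_le) fun c => ?_
      refine le_trans (le_of_eq (setLIntegral_congr_fun_ae (hAm _) ?_))
        (lintegral_mono' Measure.restrict_le_self le_rfl)
      filter_upwards [ofActZ1_val hfree c φ, ofActZ1_val hfree c₀ φ] with y h1 h2 hy
      have hk : germIndex φ y = k := hy.2
      rw [h1 hy.1, h2 hy.1, actExtFun, actExtFun, hk]

/-- The cocycles of a free action are those of its orbit groupoid. -/
def actZ1Equiv [IsFiniteMeasure μ] (hfree : IsFreeAction G μ) :
    Z1 (orbitGroupoid G μ) ≃ₜ* ActZ1 G μ :=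
  { MulEquiv.ofBijective (toActZ1Hom : Z1 (orbitGroupoid G μ) →* ActZ1 G μ)
      ⟨toActZ1_injective, fun c => ⟨ofActZ1 hfree c, toActZ1_ofActZ1 hfree c⟩⟩ with
    continuous_toFun := continuous_toActZ1
    continuous_invFun := (continuous_ofActZ1 hfree).congr fun c =>
      ((MulEquiv.ofBijective (toActZ1Hom : Z1 (orbitGroupoid G μ) →* ActZ1 G μ)
        ⟨toActZ1_injective, fun c => ⟨ofActZ1 hfree c, toActZ1_ofActZ1 hfree c⟩⟩).symm_apply_eq.2
          (toActZ1_ofActZ1 hfree c).symm).symm }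

theorem mem_B1_iff_toActZ1_mem (w : Z1 (orbitGroupoid G μ)) :
    w ∈ B1 (orbitGroupoid G μ) ↔ toActZ1 w ∈ ActB1 G μ := by
  have key : ∀ (u : X →ₘ[μ] Circle) (g : G), ∀ᵐ y ∂μ,
      toC (u⁻¹ * sigma g u) y = conj (toC u y) * toC u (g⁻¹ • y) := by
    intro u g
    filter_upwards [coeFn_toC_mul u⁻¹ (sigma g u), coeFn_toC_inv u, coeFn_toC_sigma g u]
      with y h1 h2 h3
    rw [h1, h2, h3]
  constructor
  · rintro ⟨u, hu⟩
    refine ⟨u, fun g => toC_injective (AEEqFun.ext ?_)⟩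
    rw [toC_toActZ1, hu]
    filter_upwards [key u g, AEEqFun.coeFn_mul (star (toC u)) ((smulElt μ g).1.act (toC u)),
      AEEqFun.coeFn_star (toC u), (smulElt μ g).1.coeFn_act (toC u)] with y h1 h2 h3 h4
    rw [h1, h2, Pi.mul_apply, h3, h4,
      indicator_of_mem (show y ∈ (smulElt μ g).1.target from trivial)]
    rfl
  · rintro ⟨u, hu⟩
    refine mem_B1_iff.2 ⟨toC u, (toC u).measurable, ae_norm_toC u, fun φ => ?_⟩
    filter_upwards [ae_all_iff.2 (key u), ae_val_eq_smulElt w φ, ae_exists_invFun_eq φ]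
      with y h1 h2 h3 hy
    obtain ⟨g, hg⟩ := h3 hy
    rw [h2 hy g hg, ← toC_toActZ1, hu, h1, hg]

theorem exists_ActH1_equiv [IsFiniteMeasure μ] (hfree : IsFreeAction G μ) :
    ∃ Ψ : H1 (orbitGroupoid G μ) ≃ₜ* ActH1 G μ, ∀ w : Z1 (orbitGroupoid G μ),
      Ψ (QuotientGroup.mk w) = QuotientGroup.mk (actZ1Equiv hfree w) :=
  exists_quotient_equiv (B1 (orbitGroupoid G μ)) (ActB1 G μ) toActZ1Hom continuous_toActZ1
    (ofActZ1 hfree) (continuous_ofActZ1 hfree) (toActZ1_ofActZ1 hfree) mem_B1_iff_toActZ1_mem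

end Actions

/-! ### Orbit equivalence -/

section OrbitEquivalence

variable {X Y : Type*} [MeasurableSpace X] [MeasurableSpace Y] {μ : Measure X} {ν : Measure Y}
  {G H : Type*} [Group G] [MulAction G X] [MeasurableConstSMul G X] [Group H] [MulAction H Y]

theorem orbitGroupoid_ergodic [ErgodicSMul G X μ] : (orbitGroupoid G μ).Ergodic := by
  intro E hE hinv
  have h := aeconst_of_forall_preimage_smul_ae_eq G hE.nullMeasurableSet (μ := μ) fun g => by
    filter_upwards [hinv _ (ofSMul_mem G μ g)] with x hx
    exact propext (hx trivial).symm
  rcases eventuallyConst_set'.1 h with h | h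
  · exact Or.inl (ae_eq_empty.1 h)
  · exact Or.inr (ae_eq_univ.1 h)

/-- An orbit equivalence carries the orbit groupoid of one action onto that of the other. -/
theorem mem_orbitGroupoid_iff_push_mem [Countable G] [SMulInvariantMeasure G X μ]
    [SMulInvariantMeasure H Y ν]
    (Ψ : Embed μ ν) (h : ∀ᵐ x ∂μ, Ψ '' MulAction.orbit G x = MulAction.orbit H (Ψ x))
    (φ : LocalIso μ) :
    φ ∈ (orbitGroupoid G μ).carrier ↔ Ψ.push φ ∈ (orbitGroupoid H ν).carrier := by
  constructor
  · intro hφ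
    have hφ' : ∀ᵐ x ∂μ, x ∈ φ.source → ∃ g : G, φ x = g • x := hφ
    change ∀ᵐ y ∂ν, y ∈ (Ψ.push φ).source → ∃ k : H, Ψ.push φ y = k • y
    filter_upwards [Ψ.ae_comp_inv hφ', Ψ.ae_comp_inv h] with y h1 h2 hy
    obtain ⟨hy1, hy2, -⟩ := (Ψ.mem_push_source φ y).1 hy
    obtain ⟨g, hg⟩ := h1 hy1 hy2
    have h3 : Ψ (φ (Ψ.invFun y)) ∈ MulAction.orbit H (Ψ (Ψ.invFun y)) := by
      rw [← h2 hy1, hg]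
      exact mem_image_of_mem _ ⟨g, rfl⟩
    rw [show Ψ (Ψ.invFun y) = y from Ψ.right_inv' hy1] at h3
    obtain ⟨k, hk⟩ := h3
    exact ⟨k, hk.symm⟩
  · intro hφ
    have hφ' : ∀ᵐ y ∂ν, y ∈ (Ψ.push φ).source → ∃ k : H, Ψ.push φ y = k • y := hφ
    change ∀ᵐ x ∂μ, x ∈ φ.source → ∃ g : G, φ x = g • x
    filter_upwards [Ψ.ae_comp hφ', h, Ψ.ae_source, φ.ae_comp Ψ.ae_source,
      ae_all_iff.2 fun g : G => ae_smul Ψ.ae_source g] with x h1 h2 h3 h4 h5 hx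
    have e : Ψ.invFun (Ψ x) = x := Ψ.left_inv' h3
    obtain ⟨k, hk⟩ := h1 ((Ψ.mem_push_source φ _).2
      ⟨Ψ.map_source' h3, by rwa [e], by rw [e]; exact h4 hx⟩)
    rw [Embed.push_apply, e] at hk
    have h6 : Ψ (φ x) ∈ Ψ '' MulAction.orbit G x := by
      rw [h2, hk]
      exact ⟨k, rfl⟩
    obtain ⟨_, ⟨g, rfl⟩, hg⟩ := h6
    refine ⟨g, ?_⟩
    have h7 : Ψ.invFun (Ψ (g • x)) = g • x := Ψ.left_inv' (h5 g)
    have h8 : Ψ.invFun (Ψ (φ x)) = φ x := Ψ.left_inv' (h4 hx)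
    rw [← h8, ← hg]
    exact h7

end OrbitEquivalence

end FullGpd

end

theorem mainTheorem9 :
    -- `H¹(𝒢^t)` is naturally isomorphic to `H¹(𝒢)`
    (∀ (X : Type*) [MeasurableSpace X] [StandardBorelSpace X] (μ : Measure X)
        [IsProbabilityMeasure μ] (𝒢 : FullGroupoid μ), 𝒢.Ergodic →
      ∀ (t : ℝ) (n : ℕ) (S : Set (X × Fin n)) (hS : MeasurableSet S), 0 < t → t ≤ n →
        (μ.prod (unif n)) S = ENNReal.ofReal (t / n) →
        ∃! Φ : H1 𝒢 ≃ₜ* H1 ((𝒢.matrix n).restrict S hS),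
          ∀ (w : Z1 (𝒢.matrix n)) (i : Fin n),
            Φ (QuotientGroup.mk (w.slice i)) = QuotientGroup.mk (w.restrict S hS)) ∧
    -- `Z¹(σ) = Z¹(𝒢_σ)` and `H¹(σ) = H¹(𝒢_σ)`
    (∀ (X : Type*) [MeasurableSpace X] [StandardBorelSpace X] (μ : Measure X)
        [IsProbabilityMeasure μ] (G : Type*) [Group G] [Countable G] [MulAction G X]
        [MeasurableConstSMul G X] [ErgodicSMul G X μ], IsFreeAction G μ →
      ∃ Φ : Z1 (orbitGroupoid G μ) ≃ₜ* ActZ1 G μ,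
        (∀ w g, toC ((Φ w).1 g) = w.val ⟨LocalIso.ofSMul G μ g, ofSMul_mem G μ g⟩) ∧
        (∀ w, w ∈ B1 (orbitGroupoid G μ) ↔ Φ w ∈ ActB1 G μ) ∧
        ∃ Ψ : H1 (orbitGroupoid G μ) ≃ₜ* ActH1 G μ,
          ∀ w, Ψ (QuotientGroup.mk w) = QuotientGroup.mk (Φ w)) ∧
    -- invariance under stable orbit equivalence, resp. orbit equivalence
    (∀ (X : Type*) [MeasurableSpace X] [StandardBorelSpace X] (μ : Measure X)
        [IsProbabilityMeasure μ] (G : Type*) [Group G] [Countable G] [MulAction G X]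
        [MeasurableConstSMul G X] [ErgodicSMul G X μ]
        (Y : Type*) [MeasurableSpace Y] [StandardBorelSpace Y] (ν : Measure Y)
        [IsProbabilityMeasure ν] (H : Type*) [Group H] [Countable H] [MulAction H Y]
        [MeasurableConstSMul H Y] [ErgodicSMul H Y ν], IsFreeAction G μ → IsFreeAction H ν →
      (StablyOrbitEquivalent G H μ ν → Nonempty (ActH1 G μ ≃ₜ* ActH1 H ν)) ∧
      (OrbitEquivalent G H μ ν → Nonempty (ActZ1 G μ ≃ₜ* ActZ1 H ν))) := by
  refine ⟨?_, ?_, ?_⟩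
  · intro X _ _ μ _ 𝒢 h𝒢 t n S hS ht htn hμS
    have hn : (0 : ℝ) < n := ht.trans_le htn
    refine existsUnique_H1_amplification h𝒢 hS ?_
    rw [hμS]
    exact (ENNReal.ofReal_pos.2 (div_pos ht hn)).ne'
  · intro X _ _ μ _ G _ _ _ _ _ hfree
    exact ⟨actZ1Equiv hfree, toC_toActZ1, mem_B1_iff_toActZ1_mem, exists_ActH1_equiv hfree⟩
  · intro X _ _ μ _ G _ _ _ _ _ Y _ _ ν _ H _ _ _ _ _ hG hH
    refine ⟨?_, ?_⟩
    · rintro ⟨t, ht, n, S, hS, htn, hμS, Θ, hΘ, hiso⟩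
      have hn : (0 : ℝ) < n := ht.trans_le htn
      obtain ⟨Φ, -, -⟩ := existsUnique_H1_amplification (orbitGroupoid_ergodic (G := H) (μ := ν))
        hS (by rw [hμS]; exact (ENNReal.ofReal_pos.2 (div_pos ht hn)).ne')
      obtain ⟨Φ', -⟩ := (Sweep.ofConull _ Θ hΘ).exists_H1_equiv hiso
      obtain ⟨ΨG, -⟩ := exists_ActH1_equiv hG
      obtain ⟨ΨH, -⟩ := exists_ActH1_equiv hH
      exact ⟨((ΨG.symm.trans Φ'.symm).trans Φ.symm).trans ΨH⟩
    · rintro ⟨Ψ, hΨ, horb⟩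
      obtain ⟨e⟩ := exists_Z1_equiv Ψ hΨ
        (mem_orbitGroupoid_iff_push_mem (G := G) (H := H) Ψ horb)
      exact ⟨((actZ1Equiv hG).symm.trans e.symm).trans (actZ1Equiv hH)⟩
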